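/- Let $m\ge 1$ and $n>2m$. A configuration $\Lambda=(\Lambda_1,\dots,\Lambda_n)$ of vectors of $\mathbb C^m=\mathbb R^{2m}$ is *admissible* if $0$ lies in the convex hull $\mathcal H(\Lambda)$ (Siegel condition) and if $0\in\mathcal H((\Lambda_i)_{i\in I})$ implies $|I|>2m$ (weak hyperbolicity). For such a $\Lambda$ let $$V_\Lambda=\{[z]\in\mathbb P^{n-1}\mid 0\in\mathcal H((\Lambda_i)_{z_i\ne 0})\},$$ and let $N_\Lambda$ be the leaf space of the foliation $\mathcal F_\Lambda$ of $V_\Lambda$ by the orbits of $T\cdot[z]=[e^{\langle\Lambda_1,T\rangle}z_1,\dots,e^{\langle\Lambda_n,T\rangle}z_n]$, $T\in\mathbb C^m$, where $\langle\Lambda_i,T\rangle=\sum_k\Lambda_{i,k}T_k$. With the complex structure for which the projection $V_\Lambda\to N_\Lambda$ is a holomorphic submersion, $N_\Lambda$ is a compact complex manifold of dimension $n-m-1$ (an *LV-M manifold*). A *wall* of $\Lambda$ is a real affine hyperplane $W$ of $\mathbb C^m$ which passes through exactly $2m$ of the vectors $\Lambda_i$, is spanned by them, and does not support a facet of $\mathcal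 H(\Lambda)$. We say that $\Lambda'$ is obtained from $\Lambda$ by *crossing the wall* $W$ if $\Lambda'=\Lambda+v:=(\Lambda_i+v)_i$ for some $v\in\mathbb C^m$, and there is $t_0\in(0,1)$ such that, for $t\in[0,1]$, $\Lambda+tv$ is admissible if and only if $t\ne t_0$, such that $0\in W+t_0v$ and $0\notin W_1+t_0v$ for every other wall $W_1$ of $\Lambda$, and such that at $t_0$ weak hyperbolicity fails only along $W$: if $|I|\le 2m$ and $0\in\mathcal H((\Lambda_i+t_0v)_{i\in I})$, then $\Lambda_i\in W$ for all $i\in I$. Let $\Lambda,\Lambda'$ be admissible and let $\Lambda'=\Lambda+v$ be obtained from $\Lambda$ by crossing the wall $W$. Let $I$ be the set of $i$ such that $\Lambda_i$ and $0$ lie strictly on opposite sides of $W$, and $I'$ the set of $i$ such that $\Lambda'_i$ and $0$ lie strictly on opposite sides of $W+v$. Let $X_F\subset N_\Lambda$ and $X'_{F'}\subset N_{\Lambda'}$ be the images of $V_\Lambda\cap\{z_i=0,\ i\in I\}$ and of $V_{\Lambda'}\cap\{z_i=0,\ i\in I'\}$. Then $X_F$ and $X'_{F'}$ are non-empty closed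 holomorphic submanifolds of positive codimensions $|I|$ and $|I'|$, and the identity of $V_\Lambda\cap V_{\Lambda'}$ descends to a biholomorphism $f:N_\Lambda\setminus X_F\to N_{\Lambda'}\setminus X'_{F'}$. Consequently $N_{\Lambda'}$ is obtained from $N_\Lambda$ by a holomorphic surgery along $(X_F,N_\Lambda,X'_{F'},N_{\Lambda'},f)$, and $N_\Lambda$ and $N_{\Lambda'}$ are both holomorphic compactifications (compact Hausdorff complex manifolds containing it as a dense open complex submanifold, via the inclusion and via $f$ respectively) of the same open complex manifold $N_\Lambda\setminus X_F$. Here a complex manifold $M'$ is obtained from $M$ by a *holomorphic surgery* along $(S,U,S',U',f)$ if $S\subset M$ and $S'\subset M'$ are closed holomorphic submanifolds with open neighbourhoods $U$ and $U'$, $f:U\setminus S\to U'\setminus S'$ is a biholomorphism, and $M'$ is the gluing of $M\setminus S$ and $U'$ by $f$, i.e. $f$ extends to a biholomorphism $M\setminus S\to M'\setminus S'$. -/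

import Mathlib

open scoped Manifold ContDiff Pointwise Matrix

noncomputable section

namespace LVM

/-! ### Configurations of vectors, walls, wall-crossings

The real vector space `ℝ^p`, `p = 2m`, is `ℂ^m = Fin m → ℂ` with its underlying real structure. -/

/-- Admissible configurations of `n` vectors of `ℂ^m = ℝ^{2m}`. -/
structure Admissible {m n : ℕ} (Λ : Fin n → Fin m → ℂ) : Prop where
  /-- the Siegel condition -/
  siegel : (0 : Fin m → ℂ) ∈ convexHull ℝ (Set.range Λ)
  /-- the weak hyperbolicity condition -/
  weakHyperbolicity : ∀ I : Finset (Fin n),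
    (0 : Fin m → ℂ) ∈ convexHull ℝ (Λ '' I) → 2 * m < I.card

/-- `W` is a hyperplane supporting a facet of the polytope `K`, that is, `K` lies in one of the
two closed half-spaces bounded by `W`, and the face `W ∩ K` spans `W`. -/
def SupportsFacet {m : ℕ} (W : AffineSubspace ℝ (Fin m → ℂ)) (K : Set (Fin m → ℂ)) : Prop :=
  (∃ (l : (Fin m → ℂ) →ₗ[ℝ] ℝ) (c : ℝ), l ≠ 0 ∧ (∀ x, x ∈ W ↔ l x = c) ∧ ∀ x ∈ K, l x ≤ c) ∧
    affineSpan ℝ ((W : Set (Fin m → ℂ)) ∩ K) = W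

/-- A wall of a configuration of vectors in `ℝ^{2m}`: a real affine hyperplane passing through
exactly `2m` vectors of the configuration (counted with multiplicity), determined by these
vectors, and which does not support a facet of the convex hull of the configuration. -/
structure IsWall {m n : ℕ} (Λ : Fin n → Fin m → ℂ) (W : AffineSubspace ℝ (Fin m → ℂ)) :
    Prop where
  hyperplane : Module.finrank ℝ W.direction + 1 = 2 * m
  card_eq : {i | Λ i ∈ W}.ncard = 2 * m
  span_eq : affineSpan ℝ (Λ '' {i | Λ i ∈ W}) = W
  not_supportsFacet : ¬ SupportsFacet W (convexHull ℝ (Set.range Λ))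

/-- The configuration translated by a vector. -/
def translate {m n : ℕ} (Λ : Fin n → Fin m → ℂ) (v : Fin m → ℂ) : Fin n → Fin m → ℂ :=
  fun i => Λ i + v

/-- `Λ'` is obtained from `Λ` by crossing the wall `W` (with translation vector `v`). -/
structure CrossesWall {m n : ℕ} (Λ Λ' : Fin n → Fin m → ℂ)
    (W : AffineSubspace ℝ (Fin m → ℂ)) (v : Fin m → ℂ) : Prop where
  isWall : IsWall Λ W
  eq_translate : Λ' = translate Λ v
  crossing : ∃ t₀ ∈ Set.Ioo (0 : ℝ) 1,
    -- `Λ + t v` is admissible for all `t ∈ [0, 1]` except exactly for `t = t₀`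
    (∀ t ∈ Set.Icc (0 : ℝ) 1, Admissible (translate Λ (t • v)) ↔ t ≠ t₀) ∧
    -- at `t₀`, the origin lies on the translate of `W`, and on the translate of no other wall
    0 ∈ (t₀ • v) +ᵥ W ∧
    (∀ W₁, IsWall Λ W₁ → W₁ ≠ W → 0 ∉ (t₀ • v) +ᵥ W₁) ∧
    -- at `t₀`, the weak hyperbolicity condition fails along `W` only
    (∀ I : Finset (Fin n), I.card ≤ 2 * m →
      (0 : Fin m → ℂ) ∈ convexHull ℝ (translate Λ (t₀ • v) '' I) → ∀ i ∈ I, Λ i ∈ W)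

/-- The indices of the vectors of `Λ` lying strictly on the side of the hyperplane `W` which does
not contain the origin. -/
def farIndices {m n : ℕ} (Λ : Fin n → Fin m → ℂ) (W : AffineSubspace ℝ (Fin m → ℂ)) :
    Set (Fin n) :=
  {i | W.SOppSide 0 (Λ i)}

/-! ### The manifold `N_Λ` -/

/-- Homogeneous coordinates `z ∈ ℂ^n` of the points of `V ⊆ ℙ^{n-1}`:
those with `0` in the convex hull of the `Λ i`, `z i ≠ 0` (in particular `z ≠ 0`). -/
def coneSet {m n : ℕ} (Λ : Fin n → Fin m → ℂ) : Set (Fin n → ℂ) :=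
  {z | (0 : Fin m → ℂ) ∈ convexHull ℝ (Λ '' {i | z i ≠ 0})}

theorem isOpen_coneSet {m n : ℕ} (Λ : Fin n → Fin m → ℂ) : IsOpen (coneSet Λ) := by
  rw [isOpen_iff_mem_nhds]
  intro z hz
  have h : ∀ᶠ w : Fin n → ℂ in nhds z, ∀ i, z i ≠ 0 → w i ≠ 0 := by
    rw [Filter.eventually_all]
    intro i
    by_cases hi : z i = 0
    · simp [hi]
    · filter_upwards [(continuous_apply i).continuousAt.eventually_ne hi] with w hw _ using hw
  filter_upwards [h] with w hw
  exact convexHull_mono (Set.image_mono fun i hi => hw i hi) hz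

/-- The open cone over `V` in `ℂ^n`, an open complex manifold. -/
def cone {m n : ℕ} (Λ : Fin n → Fin m → ℂ) : TopologicalSpace.Opens (Fin n → ℂ) :=
  ⟨coneSet Λ, isOpen_coneSet Λ⟩

/-- Two points of the cone are related when the points of `V ⊆ ℙ^{n-1}` with these homogeneous
coordinates lie on the same leaf of the foliation, that is on the same orbit of the `ℂ^m`-action
`T • [z] = [exp ⟨Λ 1, T⟩ z 1, …, exp ⟨Λ n, T⟩ z n]`. -/
def leafSetoid {m n : ℕ} (Λ : Fin n → Fin m → ℂ) : Setoid (cone Λ) where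
  r z w := ∃ (c : ℂ) (T : Fin m → ℂ), c ≠ 0 ∧
    ∀ i, (w : Fin n → ℂ) i = c * (Complex.exp (Λ i ⬝ᵥ T) * (z : Fin n → ℂ) i)
  iseqv :=
    { refl := fun z => ⟨1, 0, one_ne_zero, by simp⟩
      symm := by
        rintro z w ⟨c, T, hc, h⟩
        refine ⟨c⁻¹, -T, inv_ne_zero hc, fun i => ?_⟩
        rw [h i, dotProduct_neg, Complex.exp_neg]
        have := Complex.exp_ne_zero (Λ i ⬝ᵥ T)
        field_simp
      trans := by
        rintro z w u ⟨c, T, hc, h⟩ ⟨d, S, hd, h'⟩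
        refine ⟨d * c, S + T, mul_ne_zero hd hc, fun i => ?_⟩
        rw [h' i, h i, dotProduct_add, Complex.exp_add]
        ring }

/-- The leaf space `N_Λ` of the foliation of `V ⊆ ℙ^{n-1}`, with the quotient topology. -/
def N {m n : ℕ} (Λ : Fin n → Fin m → ℂ) : Type := Quotient (leafSetoid Λ)

instance {m n : ℕ} (Λ : Fin n → Fin m → ℂ) : TopologicalSpace (N Λ) :=
  inferInstanceAs (TopologicalSpace (Quotient (leafSetoid Λ)))

/-- The projection onto the leaf space, in homogeneous coordinates. -/
def proj {m n : ℕ} (Λ : Fin n → Fin m → ℂ) (z : cone Λ) : N Λ := Quotient.mk (leafSetoid Λ) z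

/-- The model of `N_Λ`, a complex vector space of dimension `n - m - 1`. -/
abbrev Model (n m : ℕ) : Type := Fin (n - m - 1) → ℂ

/-- An atlas on `N_Λ` is an atlas of its quotient complex structure if it makes `N_Λ` a complex
manifold of dimension `n - m - 1` and the projection a holomorphic submersion.
(Any two such atlases define the same complex structure, since holomorphic submersions have local
holomorphic sections.) -/
structure IsQuotientComplexStructure {m n : ℕ} (Λ : Fin n → Fin m → ℂ)
    [ChartedSpace (Model n m) (N Λ)] : Prop where
  isManifold : IsManifold 𝓘(ℂ, Model n m) ω (N Λ)
  submersion : Manifold.IsSubmersion 𝓘(ℂ, Fin n → ℂ) 𝓘(ℂ, Model n m) ω (proj Λ)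

/-- The image in `N_Λ` of `V ∩ {z i = 0 | i ∈ I}`. -/
def coordLocus {m n : ℕ} (Λ : Fin n → Fin m → ℂ) (I : Set (Fin n)) : Set (N Λ) :=
  proj Λ '' {z | ∀ i ∈ I, (z : Fin n → ℂ) i = 0}

/-! ### Holomorphic surgeries and compactifications -/

section Complex

variable {E : Type*} [NormedAddCommGroup E] [NormedSpace ℂ E]
  {M : Type*} [TopologicalSpace M] [ChartedSpace E M]
  {M' : Type*} [TopologicalSpace M'] [ChartedSpace E M']

/-- `S` is a holomorphic submanifold of codimension `k` of the complex manifold `M`: around each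
of its points, it is a linear subspace of codimension `k` in some holomorphic chart of `M`. -/
def IsComplexSubmanifold (E : Type*) [NormedAddCommGroup E] [NormedSpace ℂ E]
    {M : Type*} [TopologicalSpace M] [ChartedSpace E M] (S : Set M) (k : ℕ) : Prop :=
  ∀ p ∈ S, ∃ e ∈ IsManifold.maximalAtlas 𝓘(ℂ, E) ω M, p ∈ e.source ∧
    ∃ F : Submodule ℂ E, Module.finrank ℂ F + k = Module.finrank ℂ E ∧
      ∀ q ∈ e.source, q ∈ S ↔ e q ∈ F

/-- A homeomorphism between the open sets `f.source` and `f.target` of two complex manifolds is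
a biholomorphism. -/
def IsBiholomorphic (E : Type*) [NormedAddCommGroup E] [NormedSpace ℂ E]
    {M : Type*} [TopologicalSpace M] [ChartedSpace E M]
    {M' : Type*} [TopologicalSpace M'] [ChartedSpace E M']
    (f : OpenPartialHomeomorph M M') : Prop :=
  ContMDiffOn 𝓘(ℂ, E) 𝓘(ℂ, E) ω f f.source ∧
    ContMDiffOn 𝓘(ℂ, E) 𝓘(ℂ, E) ω f.symm f.target

/-- The complex manifold `M'` is obtained from the complex manifold `M` by a holomorphic surgery
along `(S, W, S', W', f)`, where `S` is a closed holomorphic submanifold of `M`, where `W` is an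
open neighborhood of `S`, where `S'` is a closed holomorphic submanifold of `M'` with open
neighborhood `W'`, and `f : W ∖ S → W' ∖ S'` is a biholomorphism: `M'` is the gluing of `M ∖ S`
and of `W'` by `f`. The last condition says that `f` extends to an identification of `M ∖ S` with
the complement of `S'` in `M'`. -/
structure IsHolomorphicSurgery (E : Type*) [NormedAddCommGroup E] [NormedSpace ℂ E]
    {M : Type*} [TopologicalSpace M] [ChartedSpace E M]
    {M' : Type*} [TopologicalSpace M'] [ChartedSpace E M']
    (S W : Set M) (S' W' : Set M') (f : OpenPartialHomeomorph M M') : Prop where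
  isClosed : IsClosed S
  submanifold : ∃ k, IsComplexSubmanifold E S k
  isOpen : IsOpen W
  subset : S ⊆ W
  isClosed' : IsClosed S'
  submanifold' : ∃ k, IsComplexSubmanifold E S' k
  isOpen' : IsOpen W'
  subset' : S' ⊆ W'
  source_eq : f.source = W \ S
  target_eq : f.target = W' \ S'
  biholomorphic : IsBiholomorphic E f
  gluing : ∃ g : OpenPartialHomeomorph M M', g.source = Sᶜ ∧ g.target = S'ᶜ ∧
    IsBiholomorphic E g ∧ Set.EqOn g f (W \ S)

/-- The complex manifold `X` is, through the open holomorphic embedding `j`, a holomorphic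
compactification of the complex manifold `U`. -/
structure IsHolomorphicCompactification (E : Type*) [NormedAddCommGroup E] [NormedSpace ℂ E]
    {U : Type*} [TopologicalSpace U] [ChartedSpace E U]
    {X : Type*} [TopologicalSpace X] [ChartedSpace E X] (j : U → X) : Prop where
  compact : CompactSpace X
  hausdorff : T2Space X
  isManifold : IsManifold 𝓘(ℂ, E) ω X
  isOpenEmbedding : Topology.IsOpenEmbedding j
  isLocalDiffeomorph : IsLocalDiffeomorph 𝓘(ℂ, E) 𝓘(ℂ, E) ω j
  denseRange : DenseRange j

end Complex

end LVM

end

/-!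
Let `Λ` be an admissible configuration of `n` vectors of `ℂ^m`. Weak hyperbolicity and
Carathéodory's theorem show that, when the origin is in the convex hull of a subconfiguration,
it is in its interior (`Admissible.exists_rePair_pos`). Since the functions `T ↦ Re ⟨Λ i, T⟩`
control the moduli of the coordinates along the orbits, this makes the action of `ℂˣ × ℂ^m` on the
cone over `V` proper (`exists_isCompact_of_leafAct_eq`) and free (`eq_of_leafAct_eq_self`). Hence
the leaf space is Hausdorff. It is compact because every orbit has a point with `∑ |z i|² Λ i = 0`,
which minimizes the norm on the orbit.

Near a point `z₀`, one chooses `m + 1` nonvanishing coordinates whose exponents form a coordinate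
system of `ℂ × ℂ^m` (`Frame`), and uses the action to bring these coordinates to their values at
`z₀`. The other `n - m - 1` coordinates are then coordinates on the leaf space
(`Frame.exists_leafChart`), in which the projection is a linear projection. As a submersion has
local holomorphic sections, these leaf charts belong to every quotient complex structure, and the
holomorphy of a map on the leaf space can be tested on the cone
(`IsQuotientComplexStructure.contMDiffOn_of_comp_proj`). In a leaf chart, the locus where given
coordinates vanish is a coordinate subspace (`isComplexSubmanifold_coordLocus`).

Along a path of translates `A + s v` which crosses a wall for `s = 0`, whether the origin is in the
convex hull of a subconfiguration can only change for `s = 0`, and then the origin leaves the convex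
hull through the simplex of the vectors on the wall. This cannot happen if the subconfiguration has
vectors on both sides of the wall: the simplex and these vectors then have the origin in the
interior of their convex hull (`WallPath.mem_convexHull`). Therefore the points of one cone outside
of the locus `z i = 0`, `i ∈ I`, belong to the other cone, and conversely. Translating `Λ` changes
the action only by scalars, so that the identity induces the biholomorphism between the complements
of the two loci (`exists_biholomorphism`). The loci are proper coordinate loci, so their complements
are dense.
-/

namespace LVM

open Set Filter Topology

/-! ### Real functionals and convex hulls of finite families -/

/-- The real linear functional `x ↦ Re ⟨x, T⟩` on `ℂ^m`. Every real functional has this form, so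
that the parameter `T` of the foliation plays the role of the dual space. -/
def rePair {m : ℕ} (T : Fin m → ℂ) : (Fin m → ℂ) →ₗ[ℝ] ℝ where
  toFun x := (x ⬝ᵥ T).re
  map_add' x y := by simp [add_dotProduct]
  map_smul' r x := by simp [smul_dotProduct]

theorem rePair_apply {m : ℕ} (T x : Fin m → ℂ) : rePair T x = (x ⬝ᵥ T).re := rfl

theorem rePair_smul {m : ℕ} (r : ℝ) (T x : Fin m → ℂ) : rePair (r • T) x = r * rePair T x := by
  simp [rePair_apply, dotProduct_smul]

theorem rePair_neg {m : ℕ} (T x : Fin m → ℂ) : rePair (-T) x = -rePair T x := by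
  simp [rePair_apply, dotProduct_neg]

theorem continuous_rePair {m : ℕ} (x : Fin m → ℂ) : Continuous fun T => rePair T x := by
  simp only [rePair_apply, dotProduct]
  fun_prop

theorem rePair_ne_zero {m : ℕ} {T : Fin m → ℂ} (hT : T ≠ 0) : rePair T ≠ 0 := by
  intro h
  apply hT
  ext i
  refine Complex.ext ?_ ?_
  · have := LinearMap.congr_fun h (Pi.single i 1)
    simpa [rePair_apply] using this
  · have := LinearMap.congr_fun h (Pi.single i (-Complex.I))
    simpa [rePair_apply] using this

theorem exists_eq_rePair {m : ℕ} (l : (Fin m → ℂ) →ₗ[ℝ] ℝ) : ∃ T, l = rePair T := by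
  refine ⟨fun k => l (Pi.single k 1) - Complex.I * l (Pi.single k Complex.I), ?_⟩
  refine LinearMap.ext fun x => ?_
  have hx : x = ∑ k, ((x k).re • (Pi.single k 1 : Fin m → ℂ)
      + (x k).im • (Pi.single k Complex.I : Fin m → ℂ)) := by
    ext j
    simp only [Finset.sum_apply, Pi.add_apply, Pi.smul_apply, Pi.single_apply]
    rw [Finset.sum_eq_single j (fun b _ hb => by simp [hb.symm]) (by simp)]
    simp [Complex.re_add_im]
  conv_lhs => rw [hx]
  simp [rePair_apply, dotProduct, Complex.mul_re]

theorem finrank_ker_rePair {m : ℕ} {T : Fin m → ℂ} (hT : T ≠ 0) :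
    Module.finrank ℝ (LinearMap.ker (rePair T)) + 1 = 2 * m := by
  have h := LinearMap.finrank_range_add_finrank_ker (rePair T)
  rw [LinearMap.range_eq_top.2 (LinearMap.surjective (rePair_ne_zero hT))] at h
  have h2 : Module.finrank ℝ (Fin m → ℂ) = 2 * m := by
    rw [Module.finrank_pi_fintype]
    simp [Complex.finrank_real_complex, mul_comm]
  rw [h2, finrank_top, Module.finrank_self] at h
  omega

theorem mem_convexHull_image_of_sum {E : Type*} [AddCommGroup E] [Module ℝ E] {n : ℕ}
    {B : Fin n → E} {S : Set (Fin n)} {w : Fin n → ℝ} {x : E} (h0 : ∀ i, 0 ≤ w i)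
    (hS : ∀ i, w i ≠ 0 → i ∈ S) (h1 : ∑ i, w i = 1) (hx : ∑ i, w i • B i = x) :
    x ∈ convexHull ℝ (B '' S) := by
  classical
  have e1 : ∑ i with w i ≠ 0, w i = 1 := by rw [Finset.sum_filter_ne_zero, h1]
  have e2 : ∑ i with w i ≠ 0, w i • B i = x := by
    rw [← hx]
    refine Finset.sum_filter_of_ne fun i _ hi h => hi ?_
    rw [h, zero_smul]
  rw [← e2]
  exact (convex_convexHull ℝ _).sum_mem (fun i _ => h0 i) e1
    fun i hi => subset_convexHull ℝ _ ⟨i, hS i (Finset.mem_filter.1 hi).2, rfl⟩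

theorem mem_convexHull_image_of_pos {E : Type*} [AddCommGroup E] [Module ℝ E] {n : ℕ}
    {B : Fin n → E} {J : Finset (Fin n)} {w : Fin n → ℝ} {x : E} (hw : ∀ i ∈ J, 0 < w i)
    (hw' : ∀ i ∉ J, w i = 0) (h1 : ∑ i, w i = 1) (hx : ∑ i, w i • B i = x) :
    x ∈ convexHull ℝ (B '' J) := by
  refine mem_convexHull_image_of_sum (fun i => ?_) (fun i hi => ?_) h1 hx
  · by_cases hi : i ∈ J
    exacts [(hw i hi).le, (hw' i hi).ge]
  · by_contra hi'
    exact hi (hw' i hi')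

theorem isCompact_convexHull_image {m n : ℕ} (B : Fin n → Fin m → ℂ) (S : Set (Fin n)) :
    IsCompact (convexHull ℝ (B '' S)) := (S.toFinite.image B).isCompact_convexHull ℝ

theorem exists_pos_of_mem_convexHull {E : Type*} [AddCommGroup E] [Module ℝ E] {n : ℕ}
    {B : Fin n → E} {S : Set (Fin n)} {x : E} (l : E →ₗ[ℝ] ℝ) (hx : x ∈ convexHull ℝ (B '' S)) :
    ∃ i ∈ S, l x ≤ l (B i) := by
  by_contra! h
  have : convexHull ℝ (B '' S) ⊆ {y | l y < l x} := by
    refine convexHull_min ?_ (convex_halfSpace_lt l.isLinear _)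
    rintro _ ⟨i, hi, rfl⟩
    exact h i hi
  exact lt_irrefl (l x) (this hx)

theorem mem_convexHull_translate_iff {m n : ℕ} (B : Fin n → Fin m → ℂ) (S : Set (Fin n))
    (v : Fin m → ℂ) :
    0 ∈ convexHull ℝ (translate B v '' S) ↔ -v ∈ convexHull ℝ (B '' S) := by
  have : translate B v '' S = v +ᵥ (B '' S) := by
    ext x
    simp [translate, mem_vadd_set, add_comm]
  rw [this, convexHull_vadd, mem_vadd_set_iff_neg_vadd_mem]
  simp

/-- If `0` is a convex combination of vectors of `B` lying in a closed half-space bounded by a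
hyperplane through `0`, then by Carathéodory's theorem it is a convex combination, with positive
coefficients, of at most `2 m` of these vectors, which lie on the hyperplane. -/
theorem exists_weights_of_rePair_nonpos {m n : ℕ} {B : Fin n → Fin m → ℂ} {S : Set (Fin n)}
    (h0 : 0 ∈ convexHull ℝ (B '' S)) {T : Fin m → ℂ} (hT : T ≠ 0)
    (hle : ∀ i ∈ S, rePair T (B i) ≤ 0) :
    ∃ (J : Finset (Fin n)) (w : Fin n → ℝ), J.card ≤ 2 * m ∧ (∀ i ∈ J, i ∈ S) ∧
      (∀ i ∈ J, rePair T (B i) = 0) ∧ (∀ i ∈ J, 0 < w i) ∧ (∀ i ∉ J, w i = 0) ∧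
      ∑ i, w i = 1 ∧ ∑ i, w i • B i = 0 := by
  classical
  obtain ⟨ι, _, z, w, hz, hind, hw, hw1, hwz⟩ := eq_pos_convex_span_of_mem_convexHull h0
  choose a haS haz using fun i => hz (mem_range_self i)
  have hinj : Function.Injective a := fun i j h => hind.injective (by rw [← haz, ← haz, h])
  have hzero : ∀ i, rePair T (z i) = 0 := by
    have hs : ∑ i, w i * rePair T (z i) = 0 := by
      simpa using congrArg (rePair T) hwz
    have hnp : ∀ i ∈ Finset.univ, w i * rePair T (z i) ≤ 0 := fun i _ =>
      mul_nonpos_of_nonneg_of_nonpos (hw i).le (haz i ▸ hle _ (haS i))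
    intro i
    have := (Finset.sum_eq_zero_iff_of_nonpos hnp).1 hs i (Finset.mem_univ i)
    exact (mul_eq_zero.1 this).resolve_left (hw i).ne'
  have hcard : Fintype.card ι ≤ 2 * m := by
    have h1 := hind.card_le_finrank_succ
    have h2 : vectorSpan ℝ (range z) ≤ LinearMap.ker (rePair T) := by
      rw [vectorSpan_def, Submodule.span_le]
      rintro _ ⟨_, ⟨i, rfl⟩, _, ⟨j, rfl⟩, rfl⟩
      simp [hzero]
    have h3 := Submodule.finrank_mono h2
    have h4 := finrank_ker_rePair hT
    omega
  refine ⟨Finset.univ.image a, fun k => ∑ i with a i = k, w i, ?_, ?_, ?_, ?_, ?_, ?_, ?_⟩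
  · exact Finset.card_image_le.trans (by simpa using hcard)
  · simpa using haS
  · simpa [haz] using hzero
  · simp only [Finset.mem_image, Finset.mem_univ, true_and, forall_exists_index,
      forall_apply_eq_imp_iff]
    intro i
    exact Finset.sum_pos (fun j _ => hw j) ⟨i, by simp⟩
  · intro k hk
    refine Finset.sum_eq_zero fun i hi => (hk ?_).elim
    simp only [Finset.mem_filter] at hi
    exact Finset.mem_image.2 ⟨i, Finset.mem_univ _, hi.2⟩
  · rw [Finset.sum_fiberwise, hw1]
  · rw [← hwz, ← Finset.sum_fiberwise Finset.univ a]
    refine Finset.sum_congr rfl fun k _ => ?_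
    rw [Finset.sum_smul]
    refine Finset.sum_congr rfl fun i hi => ?_
    rw [← haz, (Finset.mem_filter.1 hi).2]

/-- Weak hyperbolicity improves the membership of `0` in a convex hull to membership in its
interior, here in dual form. -/
theorem Admissible.exists_rePair_pos {m n : ℕ} {Λ : Fin n → Fin m → ℂ} (hΛ : Admissible Λ)
    {S : Set (Fin n)} (h0 : 0 ∈ convexHull ℝ (Λ '' S)) {T : Fin m → ℂ} (hT : T ≠ 0) :
    ∃ i ∈ S, 0 < rePair T (Λ i) := by
  by_contra! h
  obtain ⟨J, w, hJ, hJS, -, hw, hw', h1, hs⟩ := exists_weights_of_rePair_nonpos h0 hT h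
  exact (hΛ.weakHyperbolicity J (mem_convexHull_image_of_pos hw hw' h1 hs)).not_ge hJ

theorem exists_norm_le_rePair {m n : ℕ} (hm : 0 < m) {B : Fin n → Fin m → ℂ} {S : Set (Fin n)}
    (hB : ∀ T, T ≠ 0 → ∃ i ∈ S, 0 < rePair T (B i)) :
    ∃ ε > 0, ∀ T, ∃ i ∈ S, ε * ‖T‖ ≤ rePair T (B i) := by
  classical
  have : Nonempty (Fin m) := ⟨⟨0, hm⟩⟩
  set s : Finset (Fin n) := S.toFinite.toFinset with hs
  have hne : s.Nonempty := by
    obtain ⟨i, hi, -⟩ := hB 1 one_ne_zero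
    exact ⟨i, by simpa [hs] using hi⟩
  -- the maximum of the functionals has a positive minimum on the unit sphere
  have hcont : Continuous fun T => s.sup' hne fun i => rePair T (B i) :=
    Continuous.finset_sup'_apply hne fun i _ => continuous_rePair (B i)
  obtain ⟨T₀, hT₀, hmin⟩ := (isCompact_sphere (0 : Fin m → ℂ) 1).exists_isMinOn
    (NormedSpace.sphere_nonempty.2 zero_le_one) hcont.continuousOn
  refine ⟨s.sup' hne fun i => rePair T₀ (B i), ?_, fun T => ?_⟩
  · obtain ⟨i, hi, hpos⟩ := hB T₀ (by rintro rfl; simp at hT₀)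
    exact hpos.trans_le (Finset.le_sup' (fun i => rePair T₀ (B i)) (by simpa [hs] using hi))
  · rcases eq_or_ne T 0 with rfl | hT
    · obtain ⟨i, hi⟩ := hne
      exact ⟨i, by simpa [hs] using hi, by simp [rePair_apply]⟩
    · have hT' : 0 < ‖T‖ := norm_pos_iff.2 hT
      have h1 : (‖T‖⁻¹ • T) ∈ Metric.sphere (0 : Fin m → ℂ) 1 := by
        simp [norm_smul, hT'.ne']
      obtain ⟨i, hi, he⟩ := s.exists_mem_eq_sup' hne fun i => rePair (‖T‖⁻¹ • T) (B i)
      refine ⟨i, by simpa [hs] using hi, ?_⟩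
      have h2 : s.sup' hne (fun i => rePair T₀ (B i)) ≤ _ := hmin h1
      simp only at h2
      rw [he, rePair_smul] at h2
      calc _ ≤ (‖T‖⁻¹ * rePair T (B i)) * ‖T‖ := by gcongr
        _ = _ := by field_simp

theorem zero_mem_interior_convexHull {m n : ℕ} (hm : 0 < m) {B : Fin n → Fin m → ℂ}
    {S : Set (Fin n)} (hB : ∀ T, T ≠ 0 → ∃ i ∈ S, 0 < rePair T (B i)) :
    0 ∈ interior (convexHull ℝ (B '' S)) := by
  obtain ⟨ε, hε, h⟩ := exists_norm_le_rePair hm hB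
  have hM : ∃ M : ℝ, 0 < M ∧ ∀ T y : Fin m → ℂ, rePair T y ≤ M * ‖y‖ * ‖T‖ := by
    refine ⟨m, by exact_mod_cast hm, fun T y => ?_⟩
    calc rePair T y ≤ ‖y ⬝ᵥ T‖ := Complex.re_le_norm _
      _ ≤ ∑ i, ‖y i * T i‖ := norm_sum_le _ _
      _ ≤ ∑ i : Fin m, ‖y‖ * ‖T‖ := by
        refine Finset.sum_le_sum fun i _ => ?_
        rw [norm_mul]
        gcongr <;> exact norm_le_pi_norm _ _
      _ = _ := by simp [mul_assoc]
  obtain ⟨M, hM0, hM⟩ := hM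
  rw [mem_interior_iff_mem_nhds]
  refine Filter.mem_of_superset (Metric.ball_mem_nhds 0 (div_pos hε hM0)) fun y hy => ?_
  by_contra hy'
  obtain ⟨f, u, hf, hu⟩ := geometric_hahn_banach_closed_point (convex_convexHull ℝ _)
    (isCompact_convexHull_image B S).isClosed hy'
  obtain ⟨T, hT⟩ := exists_eq_rePair f.toLinearMap
  have hT' : ∀ x, f x = rePair T x := fun x => LinearMap.congr_fun hT x
  obtain ⟨i, hi, hle⟩ := h T
  have h1 := hf _ (subset_convexHull ℝ _ ⟨i, hi, rfl⟩)
  rw [hT'] at h1 hu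
  have h2 := hM T y
  have h3 : M * ‖y‖ < ε := by
    rw [mem_ball_zero_iff, lt_div_iff₀ hM0] at hy
    linarith
  nlinarith [norm_nonneg T]

/-- Along an interval of parameters for which the translated configuration stays admissible, the
condition that `0` be in the convex hull of a given subconfiguration does not change: it is closed
because convex hulls are compact, and open by weak hyperbolicity. -/
theorem mem_convexHull_translate_of_isPreconnected {m n : ℕ} (hm : 0 < m)
    {B : Fin n → Fin m → ℂ} {v : Fin m → ℂ} {s : Set ℝ} (hs : IsPreconnected s)
    (hadm : ∀ t ∈ s, Admissible (translate B (t • v))) {S : Set (Fin n)} {t₀ t₁ : ℝ}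
    (h₀ : t₀ ∈ s) (h₁ : t₁ ∈ s) (h : 0 ∈ convexHull ℝ (translate B (t₀ • v) '' S)) :
    0 ∈ convexHull ℝ (translate B (t₁ • v) '' S) := by
  have hcont : Continuous fun t : ℝ => -(t • v) := by fun_prop
  set U : Set ℝ := (fun t : ℝ => -(t • v)) ⁻¹' interior (convexHull ℝ (B '' S)) with hU
  have hmemU : ∀ t ∈ s, 0 ∈ convexHull ℝ (translate B (t • v) '' S) → t ∈ U := by
    intro t ht h0
    have h1 := zero_mem_interior_convexHull hm
      fun T hT => (hadm t ht).exists_rePair_pos h0 hT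
    have h2 : translate B (t • v) '' S = (t • v) +ᵥ (B '' S) := by
      ext x
      simp [translate, mem_vadd_set, add_comm]
    rw [h2, convexHull_vadd, interior_vadd, mem_vadd_set_iff_neg_vadd_mem] at h1
    simpa [hU] using h1
  have hsub : s ⊆ U := by
    refine hs.subset_of_closure_inter_subset (isOpen_interior.preimage hcont)
      ⟨t₀, h₀, hmemU t₀ h₀ h⟩ ?_
    rintro t ⟨htc, hts⟩
    refine hmemU t hts ((mem_convexHull_translate_iff _ _ _).2 ?_)
    have hcl : IsClosed ((fun t : ℝ => -(t • v)) ⁻¹' convexHull ℝ (B '' S)) :=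
      (isCompact_convexHull_image B S).isClosed.preimage hcont
    exact closure_minimal (preimage_mono interior_subset) hcl htc
  exact (mem_convexHull_translate_iff _ _ _).2 (interior_subset (hsub h₁))

/-! ### Wall-crossings -/

/-- A wall-crossing, centered at the moment of the crossing: `A` is the configuration for which the
wall, now the hyperplane `rePair T = 0`, passes through the origin, and `A + s v` is admissible for
all `s ≠ 0` in `[-a, b]`. The vectors of `A` on the wall form a simplex with the origin in its
relative interior (`exists_weights`), and they are the only obstruction to the weak hyperbolicity
of `A` (`mem_iff`). The notion is symmetric under reversal of the path. -/
structure WallPath {m n : ℕ} (A : Fin n → Fin m → ℂ) (v : Fin m → ℂ) (a b : ℝ) (T : Fin m → ℂ) :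
    Prop where
  left_pos : 0 < a
  right_pos : 0 < b
  rePair_pos : 0 < rePair T v
  admissible : ∀ s ∈ Icc (-a) b, s ≠ 0 → Admissible (translate A (s • v))
  eq_smul : ∀ T', (∀ i, rePair T (A i) = 0 → rePair T' (A i) = 0) → ∃ c : ℝ, T' = c • T
  mem_iff : ∀ J : Finset (Fin n), J.card ≤ 2 * m → 0 ∈ convexHull ℝ (A '' J) →
    ∀ i, i ∈ J ↔ rePair T (A i) = 0
  exists_weights : ∃ w : Fin n → ℝ, (∀ i, rePair T (A i) = 0 → 0 < w i) ∧
    (∀ i, rePair T (A i) ≠ 0 → w i = 0) ∧ ∑ i, w i = 1 ∧ ∑ i, w i • A i = 0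

theorem WallPath.reverse {m n : ℕ} {A : Fin n → Fin m → ℂ} {v : Fin m → ℂ} {a b : ℝ}
    {T : Fin m → ℂ} (h : WallPath A v a b T) : WallPath A (-v) b a (-T) where
  left_pos := h.right_pos
  right_pos := h.left_pos
  rePair_pos := by simpa [rePair_neg] using h.rePair_pos
  admissible s hs hs0 := by
    have := h.admissible (-s) ⟨by linarith [hs.2], by linarith [hs.1]⟩ (neg_ne_zero.2 hs0)
    simpa using this
  eq_smul T' hT' := by
    obtain ⟨c, hc⟩ := h.eq_smul T' fun i hi => hT' i (by simp [rePair_neg, hi])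
    exact ⟨-c, by simp [hc]⟩
  mem_iff J hJ h0 i := by simpa [rePair_neg] using h.mem_iff J hJ h0 i
  exists_weights := by simpa [rePair_neg] using h.exists_weights

/-- If `0` is in the relative interior of the simplex of the vectors `A i`, `i ∈ Z`, the points
`r y` with `r > 0` small belong to the convex hull of the `A i`, `i ∈ S`, as soon as `y` is a
linear combination of these vectors in which only the coefficients of the `A i`, `i ∈ Z`,
may be negative. -/
theorem eventually_smul_mem_convexHull {E : Type*} [AddCommGroup E] [Module ℝ E] {n : ℕ}
    {A : Fin n → E} {Z S : Set (Fin n)} {w x : Fin n → ℝ} {y : E} (hw : ∀ i ∈ Z, 0 < w i)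
    (hw' : ∀ i ∉ Z, w i = 0) (hw1 : ∑ i, w i = 1) (hw0 : ∑ i, w i • A i = 0) (hZS : Z ⊆ S)
    (hx : ∀ i ∉ Z, 0 ≤ x i) (hxS : ∀ i, x i ≠ 0 → i ∈ S) (hy : ∑ i, x i • A i = y) :
    ∀ᶠ r : ℝ in 𝓝[>] 0, r • y ∈ convexHull ℝ (A '' S) := by
  have key : ∀ᶠ r : ℝ in 𝓝[>] 0, ∀ i, i ∈ Z → 0 < r * x i + (1 - r * ∑ j, x j) * w i := by
    rw [eventually_all]
    intro i
    by_cases hi : i ∈ Z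
    · have hc : Continuous fun r : ℝ => r * x i + (1 - r * ∑ j, x j) * w i := by fun_prop
      have h0 : 0 < (0 : ℝ) * x i + (1 - 0 * ∑ j, x j) * w i := by simpa using hw i hi
      filter_upwards [nhdsWithin_le_nhds (hc.tendsto 0 (Ioi_mem_nhds h0))] with r hr _ using hr
    · exact Eventually.of_forall fun r h => (hi h).elim
  filter_upwards [key, self_mem_nhdsWithin] with r hr hr0
  have hr0 : 0 < r := hr0
  refine mem_convexHull_image_of_sum (w := fun i => r * x i + (1 - r * ∑ j, x j) * w i)
    (fun i => ?_) (fun i hi => ?_) ?_ ?_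
  · by_cases hi : i ∈ Z
    · exact (hr i hi).le
    · simpa [hw' i hi] using mul_nonneg hr0.le (hx i hi)
  · by_cases hiZ : i ∈ Z
    · exact hZS hiZ
    · refine hxS i fun h => hi ?_
      simp [h, hw' i hiZ]
  · rw [Finset.sum_add_distrib, ← Finset.mul_sum, ← Finset.mul_sum, hw1]
    ring
  · simp_rw [add_smul, mul_smul, Finset.sum_add_distrib, ← Finset.smul_sum]
    rw [hw0, hy, smul_zero, add_zero]

/-- The vectors of the configuration lying on a hyperplane through `0` span this hyperplane if
their annihilator is a line. -/
theorem exists_sum_eq_of_rePair_eq_zero {m n : ℕ} {A : Fin n → Fin m → ℂ} {T y : Fin m → ℂ}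
    (hspan : ∀ T', (∀ i, rePair T (A i) = 0 → rePair T' (A i) = 0) → ∃ c : ℝ, T' = c • T)
    (hy : rePair T y = 0) :
    ∃ x : Fin n → ℝ, (∀ i, rePair T (A i) ≠ 0 → x i = 0) ∧ ∑ i, x i • A i = y := by
  have hmem : y ∈ Submodule.span ℝ (A '' {i | rePair T (A i) = 0}) := by
    by_contra hy'
    obtain ⟨f, hf, hle⟩ := Submodule.exists_le_ker_of_notMem hy'
    obtain ⟨T', rfl⟩ := exists_eq_rePair f
    obtain ⟨c, rfl⟩ := hspan T' fun i hi => hle (Submodule.subset_span ⟨i, hi, rfl⟩)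
    exact hf (by rw [rePair_smul, hy, mul_zero])
  rw [Finsupp.mem_span_image_iff_linearCombination] at hmem
  obtain ⟨l, hl, hly⟩ := hmem
  refine ⟨l, fun i hi => ?_, ?_⟩
  · by_contra h
    exact hi (hl (Finsupp.mem_support_iff.2 h))
  · rw [← hly, Finsupp.linearCombination_apply, Finsupp.sum_fintype _ _ (by simp)]

namespace WallPath

variable {m n : ℕ} {A : Fin n → Fin m → ℂ} {v : Fin m → ℂ} {a b : ℝ} {T : Fin m → ℂ}

theorem exists_pos (h : WallPath A v a b T) {S : Set (Fin n)}
    (hS : 0 ∈ convexHull ℝ (translate A (-a • v) '' S)) : ∃ i ∈ S, 0 < rePair T (A i) := by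
  rw [mem_convexHull_translate_iff] at hS
  obtain ⟨i, hi, hle⟩ := exists_pos_of_mem_convexHull (rePair T) hS
  refine ⟨i, hi, lt_of_lt_of_le ?_ hle⟩
  simpa using mul_pos h.left_pos h.rePair_pos

/-- A subconfiguration with the origin in its convex hull before the wall-crossing keeps this
property if it has a vector on the far side of the wall. Indeed, the origin could only leave the
convex hull through the simplex contained in the wall, but this simplex together with a vector on
each side of the wall has the origin in the interior of its convex hull. -/
theorem mem_convexHull (hm : 0 < m) (h : WallPath A v a b T) {S : Set (Fin n)}
    (hS : 0 ∈ convexHull ℝ (translate A (-a • v) '' S)) {i : Fin n} (hi : i ∈ S)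
    (hneg : rePair T (A i) < 0) : 0 ∈ convexHull ℝ (translate A (b • v) '' S) := by
  have ha := h.left_pos
  have hb := h.right_pos
  obtain ⟨j, hj, hpos⟩ := h.exists_pos hS
  have hcont : Continuous fun t : ℝ => -(t • v) := by fun_prop
  have hleft : ∀ s ∈ Ico (-a) 0, -(s • v) ∈ convexHull ℝ (A '' S) := fun s hs =>
    (mem_convexHull_translate_iff _ _ _).1 <| mem_convexHull_translate_of_isPreconnected hm
      isPreconnected_Ico (fun t ht => h.admissible t ⟨ht.1, ht.2.le.trans hb.le⟩ ht.2.ne)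
      ⟨le_rfl, by linarith⟩ hs hS
  have hzero : 0 ∈ convexHull ℝ (A '' S) := by
    have hcl : IsClosed ((fun t : ℝ => -(t • v)) ⁻¹' convexHull ℝ (A '' S)) :=
      (isCompact_convexHull_image A S).isClosed.preimage hcont
    have : (0 : ℝ) ∈ closure (Ico (-a) 0) := by
      rw [closure_Ico (by linarith)]
      exact ⟨by linarith, le_rfl⟩
    have hmem : -((0 : ℝ) • v) ∈ convexHull ℝ (A '' S) :=
      closure_minimal (s := Ico (-a) 0) hleft hcl this
    simpa using hmem
  have hint : 0 ∈ interior (convexHull ℝ (A '' S)) := by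
    refine zero_mem_interior_convexHull hm fun T' hT' => ?_
    by_contra! hle
    obtain ⟨J, w, hJ, hJS, hJT', hw, hw', h1, hs⟩ := exists_weights_of_rePair_nonpos hzero hT' hle
    have hJ0 := mem_convexHull_image_of_pos hw hw' h1 hs
    obtain ⟨c, rfl⟩ := h.eq_smul T' fun k hk => hJT' k ((h.mem_iff J hJ hJ0 k).2 hk)
    have hc : c ≠ 0 := by rintro rfl; simp at hT'
    have e1 := hle i hi
    have e2 := hle j hj
    rw [rePair_smul] at e1 e2
    rcases lt_or_gt_of_ne hc with hc | hc <;> nlinarith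
  have hev : ∀ᶠ s : ℝ in 𝓝[>] 0, -(s • v) ∈ convexHull ℝ (A '' S) := by
    refine nhdsWithin_le_nhds (hcont.tendsto 0 ?_)
    simpa using mem_interior_iff_mem_nhds.1 hint
  obtain ⟨s, hs, hs'⟩ := (hev.and (Ioc_mem_nhdsGT hb)).exists
  exact mem_convexHull_translate_of_isPreconnected hm
    isPreconnected_Ioc (fun t ht => h.admissible t ⟨by linarith [ht.1], ht.2⟩ ht.1.ne') hs'
    ⟨hb, le_rfl⟩ ((mem_convexHull_translate_iff _ _ _).2 hs)

/-- Before the wall-crossing, the vectors which are not on the far side of the wall have the origin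
in their convex hull. -/
theorem zero_mem_convexHull_nonneg (hm : 0 < m) (h : WallPath A v a b T) :
    0 ∈ convexHull ℝ (translate A (-a • v) '' {i | 0 ≤ rePair T (A i)}) := by
  have ha := h.left_pos
  have hb := h.right_pos
  obtain ⟨k, -, hk⟩ := h.exists_pos (S := univ) <| by
    have := (h.admissible (-a) ⟨le_rfl, by linarith⟩ (by linarith)).siegel
    rwa [← image_univ] at this
  obtain ⟨w, hw, hw', h1, hs⟩ := h.exists_weights
  set α := rePair T v / rePair T (A k) with hα
  have hα0 : 0 < α := div_pos h.rePair_pos hk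
  obtain ⟨x, hx, hxy⟩ := exists_sum_eq_of_rePair_eq_zero (y := v - α • A k) h.eq_smul <| by
    rw [map_sub, map_smul, smul_eq_mul, hα]
    field_simp
    simp
  have hxk : x k = 0 := hx k hk.ne'
  have hev := eventually_smul_mem_convexHull (A := A) (Z := {i | rePair T (A i) = 0})
    (S := {i | 0 ≤ rePair T (A i)}) (w := w) (x := x + Pi.single k α) (y := v) hw hw' h1 hs
    (fun i hi => (le_of_eq hi.symm :)) (fun i hi => ?_) (fun i hi => ?_) ?_
  · obtain ⟨r, hr, hr'⟩ := (hev.and (Ioc_mem_nhdsGT ha)).exists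
    refine mem_convexHull_translate_of_isPreconnected hm (t₀ := -r)
      isPreconnected_Ico (fun t ht => h.admissible t ⟨ht.1, ht.2.le.trans hb.le⟩ ht.2.ne)
      ⟨neg_le_neg hr'.2, by linarith [hr'.1]⟩ ⟨le_rfl, by linarith⟩ ?_
    rw [mem_convexHull_translate_iff]
    simpa using hr
  · rw [Pi.add_apply, hx i hi, zero_add]
    rcases eq_or_ne i k with rfl | hik
    · simpa using hα0.le
    · simp [hik]
  · by_contra hi'
    have hi' : rePair T (A i) < 0 := not_le.1 hi'
    refine hi ?_
    have hik : i ≠ k := by rintro rfl; linarith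
    simp [hx i hi'.ne, hik]
  · simp_rw [Pi.add_apply, add_smul, Finset.sum_add_distrib, hxy]
    rw [Finset.sum_eq_single k (fun j _ hj => by simp [hj]) (by simp)]
    simp

end WallPath

theorem sOppSide_iff_of_mem_iff {E : Type*} [AddCommGroup E] [Module ℝ E]
    {W : AffineSubspace ℝ E} {l : E →ₗ[ℝ] ℝ} {c : ℝ} (hW : ∀ x, x ∈ W ↔ l x = c) (x y : E) :
    W.SOppSide x y ↔ (l x - c) * (l y - c) < 0 := by
  constructor
  · rintro ⟨⟨p, hp, q, hq, hray⟩, hx, hy⟩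
    rw [hW] at hp hq hx hy
    have := hray.map l
    simp only [vsub_eq_sub, map_sub, hp, hq] at this
    have h1 : l x - c ≠ 0 := sub_ne_zero.2 hx
    have h2 : c - l y ≠ 0 := sub_ne_zero.2 (Ne.symm hy)
    obtain ⟨r, hr, he⟩ := this.exists_pos_left h1 h2
    have : l y - c = -(r * (l x - c)) := by simp only [smul_eq_mul] at he; linarith
    rw [this]
    nlinarith [mul_pos hr (mul_self_pos.2 h1)]
  · intro h
    have hx : l x - c ≠ 0 := left_ne_zero_of_mul h.ne
    have hy : l y - c ≠ 0 := right_ne_zero_of_mul h.ne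
    have hd : l x - l y ≠ 0 := by
      intro h0
      have : l x - c = l y - c := by linarith
      rw [this] at h
      nlinarith [mul_self_nonneg (l y - c)]
    refine ⟨?_, ?_, ?_⟩
    · -- the segment from `x` to `y` meets `W`
      have hr : (l x - c) / (l x - l y) ∈ Icc (0 : ℝ) 1 := by
        rcases lt_or_gt_of_ne hx with h1 | h1
        · have h2 : 0 < l y - c := by nlinarith
          exact ⟨div_nonneg_of_nonpos h1.le (by linarith),
            (div_le_one_of_neg (by linarith)).2 (by linarith)⟩
        · have h2 : l y - c < 0 := by nlinarith
          exact ⟨div_nonneg h1.le (by linarith), (div_le_one (by linarith)).2 (by linarith)⟩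
      refine Wbtw.wOppSide₁₃ ⟨_, hr, rfl⟩ ?_
      rw [hW, AffineMap.lineMap_apply_module', map_add, map_smul, map_sub, smul_eq_mul]
      field_simp
      ring
    · exact fun h' => hx (by rw [(hW x).1 h', sub_self])
    · exact fun h' => hy (by rw [(hW y).1 h', sub_self])

theorem exists_smul_eq_of_ker_le {m : ℕ} {T T' : Fin m → ℂ} (hT : T ≠ 0)
    (h : ∀ x, rePair T x = 0 → rePair T' x = 0) : ∃ c : ℝ, T' = c • T := by
  obtain ⟨x, hx⟩ := LinearMap.surjective (rePair_ne_zero hT) 1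
  refine ⟨rePair T' x, ?_⟩
  by_contra hne
  refine rePair_ne_zero (sub_ne_zero.2 hne) (LinearMap.ext fun y => ?_)
  have h1 := h (y - rePair T y • x) (by simp [hx])
  have h2 : rePair (T' - rePair T' x • T) y = rePair T' y - rePair T' x * rePair T y := by
    rw [← rePair_smul]
    simp [rePair_apply, dotProduct_sub]
  rw [h2]
  simp only [map_sub, map_smul, smul_eq_mul] at h1
  simp only [LinearMap.zero_apply]
  linarith

theorem IsWall.exists_mem_iff {m n : ℕ} {Λ : Fin n → Fin m → ℂ}
    {W : AffineSubspace ℝ (Fin m → ℂ)} (hW : IsWall Λ W) {p : Fin m → ℂ} (hp : p ∈ W) :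
    ∃ T, T ≠ 0 ∧ (∀ x, x ∈ W ↔ rePair T x = rePair T p) ∧
      ∀ T', (∀ i, Λ i ∈ W → rePair T' (Λ i) = rePair T' p) → ∃ c : ℝ, T' = c • T := by
  have h2 : Module.finrank ℝ (Fin m → ℂ) = 2 * m := by
    rw [Module.finrank_pi_fintype]
    simp [Complex.finrank_real_complex, mul_comm]
  have hlt : W.direction < ⊤ := by
    refine lt_top_iff_ne_top.2 fun h => ?_
    have := hW.hyperplane
    rw [h, finrank_top] at this
    omega
  obtain ⟨f, hf, hle⟩ := Submodule.exists_le_ker_of_lt_top _ hlt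
  obtain ⟨T, rfl⟩ := exists_eq_rePair f
  have hT : T ≠ 0 := by
    rintro rfl
    exact hf (LinearMap.ext fun x => by simp [rePair_apply])
  have hdir : W.direction = LinearMap.ker (rePair T) := by
    refine Submodule.eq_of_le_of_finrank_eq hle ?_
    have := finrank_ker_rePair hT
    have := hW.hyperplane
    omega
  have hmem : ∀ x, x ∈ W ↔ rePair T x = rePair T p := fun x => by
    rw [← AffineSubspace.vsub_right_mem_direction_iff_mem hp, hdir, LinearMap.mem_ker, vsub_eq_sub,
      map_sub, sub_eq_zero]
  refine ⟨T, hT, hmem, fun T' hT' => exists_smul_eq_of_ker_le hT fun x hx => ?_⟩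
  have hall : ∀ x ∈ W, rePair T' x = rePair T' p := by
    have hsub : W ≤ AffineSubspace.mk' p (LinearMap.ker (rePair T')) := by
      rw [← hW.span_eq, affineSpan_le]
      rintro _ ⟨i, hi, rfl⟩
      simp [AffineSubspace.mem_mk', hT' i hi]
    intro x hx
    have := hsub hx
    rwa [AffineSubspace.mem_mk', LinearMap.mem_ker, vsub_eq_sub, map_sub, sub_eq_zero] at this
  have := hall (x + p) ((hmem _).2 (by simp [hx]))
  simpa using this

theorem CrossesWall.exists_wallPath {m n : ℕ} (hn : 2 * m < n)
    {Λ Λ' : Fin n → Fin m → ℂ} {W : AffineSubspace ℝ (Fin m → ℂ)} {v : Fin m → ℂ}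
    (h : CrossesWall Λ Λ' W v) :
    ∃ (A : Fin n → Fin m → ℂ) (T : Fin m → ℂ) (a b : ℝ), WallPath A v a b T ∧
      Λ = translate A (-a • v) ∧ Λ' = translate A (b • v) ∧
      farIndices Λ W = {i | rePair T (A i) < 0} ∧
      farIndices Λ' (v +ᵥ W) = {i | 0 < rePair T (A i)} := by
  classical
  obtain ⟨t₀, ⟨ht0, ht1⟩, hadm, hW0, -, honly⟩ := h.crossing
  set A := translate Λ (t₀ • v) with hA
  have htr : ∀ s : ℝ, translate A (s • v) = translate Λ ((t₀ + s) • v) := fun s => by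
    ext i k
    simp [hA, translate, add_smul, add_assoc]
  have hp : -(t₀ • v) ∈ W := by
    rw [← AffineSubspace.vadd_mem_pointwise_vadd_iff (v := t₀ • v)]
    simpa using hW0
  obtain ⟨T₀, hT₀, hmem, hspan⟩ := h.isWall.exists_mem_iff hp
  have hmem' : ∀ i, Λ i ∈ W ↔ rePair T₀ (A i) = 0 := fun i => by
    rw [hmem, hA, translate, map_add, map_neg, eq_neg_iff_add_eq_zero]
  have hspan' : ∀ T', (∀ i, rePair T₀ (A i) = 0 → rePair T' (A i) = 0) → ∃ c : ℝ, T' = c • T₀ := by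
    refine fun T' hT' => hspan T' fun i hi => ?_
    have := hT' i ((hmem' i).1 hi)
    rwa [hA, translate, map_add, ← eq_neg_iff_add_eq_zero, ← map_neg] at this
  -- a family of at most `2 m` vectors with the origin in its convex hull fills the wall:
  -- otherwise it could be enlarged by a vector outside of the wall
  have hiff : ∀ J : Finset (Fin n), J.card ≤ 2 * m → 0 ∈ convexHull ℝ (A '' J) →
      ∀ i, i ∈ J ↔ rePair T₀ (A i) = 0 := by
    intro J hJ hJ0
    set Z : Finset (Fin n) := {i | Λ i ∈ W} with hZ
    have hZcard : Z.card = 2 * m := by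
      rw [← h.isWall.card_eq, ← Set.ncard_coe_finset]
      congr 1
      ext i
      simp [hZ]
    have hJZ : J ⊆ Z := fun i hi => by simpa [hZ] using honly J hJ hJ0 i hi
    have hge : Z.card ≤ J.card := by
      by_contra! hlt
      obtain ⟨k, hk⟩ : ∃ k, k ∉ Z := by
        by_contra! hall
        have := Finset.card_le_card (fun i _ => hall i : (Finset.univ : Finset (Fin n)) ⊆ Z)
        rw [hZcard, Finset.card_univ, Fintype.card_fin] at this
        omega
      refine hk ?_
      have := honly (insert k J) ((Finset.card_insert_le _ _).trans (by omega))
        (convexHull_mono (image_mono (by simp)) hJ0) k (Finset.mem_insert_self _ _)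
      simpa [hZ] using this
    have := Finset.eq_of_subset_of_card_le hJZ hge
    intro i
    rw [this, ← hmem']
    simp [hZ]
  have hsiegel : 0 ∈ convexHull ℝ (range A) := by
    have hcl : IsClosed ((fun t : ℝ => -(t • v)) ⁻¹' convexHull ℝ (range Λ)) := by
      rw [← image_univ]
      exact (isCompact_convexHull_image Λ univ).isClosed.preimage (by fun_prop)
    have hsub : Ico 0 t₀ ⊆ (fun t : ℝ => -(t • v)) ⁻¹' convexHull ℝ (range Λ) := by
      intro t ht
      have := ((hadm t ⟨ht.1, ht.2.le.trans ht1.le⟩).2 ht.2.ne).siegel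
      rw [← image_univ, mem_convexHull_translate_iff] at this
      simpa using this
    have hcl' := closure_minimal hsub hcl
    rw [closure_Ico ht0.ne] at hcl'
    have := hcl' ⟨ht0.le, le_rfl⟩
    rw [← image_univ, hA, mem_convexHull_translate_iff]
    simpa using this
  obtain ⟨w, hw, hw', hw1, hws⟩ : ∃ w : Fin n → ℝ, (∀ i, rePair T₀ (A i) = 0 → 0 < w i) ∧
      (∀ i, rePair T₀ (A i) ≠ 0 → w i = 0) ∧ ∑ i, w i = 1 ∧ ∑ i, w i • A i = 0 := by
    have hnot : ¬ Admissible A := fun hc => (hadm t₀ ⟨ht0.le, ht1.le⟩).1 hc rfl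
    obtain ⟨J, hJ0, hJ⟩ : ∃ J : Finset (Fin n), 0 ∈ convexHull ℝ (A '' J) ∧ J.card ≤ 2 * m := by
      by_contra! hc
      exact hnot ⟨hsiegel, hc⟩
    obtain ⟨J', w, hJ', -, -, hw, hw', h1, hs⟩ := exists_weights_of_rePair_nonpos hJ0 hT₀
      fun i hi => ((hiff J hJ hJ0 i).1 hi).le
    have hJ'iff := hiff J' hJ' (mem_convexHull_image_of_pos hw hw' h1 hs)
    exact ⟨w, fun i hi => hw i ((hJ'iff i).2 hi), fun i hi => hw' i (mt (hJ'iff i).1 hi), h1, hs⟩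
  -- a path inside the wall would meet the relative interior of the simplex at times `≠ t₀`
  have hv : rePair T₀ v ≠ 0 := by
    intro hv
    obtain ⟨x, hx, hxv⟩ := exists_sum_eq_of_rePair_eq_zero (y := -v) hspan' (by simp [hv])
    have hev := eventually_smul_mem_convexHull (A := A) (Z := {i | rePair T₀ (A i) = 0})
      (S := {i | rePair T₀ (A i) = 0}) hw hw' hw1 hws subset_rfl
      (fun i hi => (hx i hi).ge) (fun i hi => by by_contra hc; exact hi (hx i hc)) hxv
    obtain ⟨r, hr, hr'⟩ := (hev.and (Ioc_mem_nhdsGT (sub_pos.2 ht1))).exists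
    have hr1 := hr'.1
    have hr2 := hr'.2
    have hadm' := (hadm (t₀ + r) ⟨by linarith, by linarith⟩).2 (by linarith)
    rw [← htr] at hadm'
    have hcard := hadm'.weakHyperbolicity {i | Λ i ∈ W} (by
      rw [mem_convexHull_translate_iff]
      simpa [hmem'] using hr)
    rw [← Set.ncard_coe_finset] at hcard
    have := h.isWall.card_eq
    simp only [Finset.coe_filter, Finset.mem_univ, true_and] at hcard
    omega
  have hfar : ∀ i, i ∈ farIndices Λ W ↔ rePair T₀ v * rePair T₀ (A i) < 0 := fun i => by
    have e : rePair T₀ (A i) = rePair T₀ (Λ i) + t₀ * rePair T₀ v := by simp [hA, translate]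
    rw [farIndices, mem_ofPred_eq, sOppSide_iff_of_mem_iff hmem, e]
    simp only [map_zero, map_neg, map_smul, smul_eq_mul, sub_neg_eq_add, zero_add]
    rw [mul_assoc, ← neg_pos, ← mul_neg, mul_pos_iff_of_pos_left ht0, neg_pos]
  have hfar' : ∀ i, i ∈ farIndices Λ' (v +ᵥ W) ↔ 0 < rePair T₀ v * rePair T₀ (A i) := fun i => by
    have e : rePair T₀ (A i) = rePair T₀ (Λ i) + t₀ * rePair T₀ v := by simp [hA, translate]
    have hmemv : ∀ x, x ∈ v +ᵥ W ↔ rePair T₀ x = rePair T₀ (v - t₀ • v) := fun x => by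
      have : x = v +ᵥ (x - v) := by simp
      rw [this, AffineSubspace.vadd_mem_pointwise_vadd_iff, hmem]
      simp only [vadd_eq_add, map_add, map_sub, map_neg, map_smul]
      constructor <;> intro h <;> linarith
    rw [farIndices, mem_ofPred_eq, sOppSide_iff_of_mem_iff hmemv, e, h.eq_translate]
    simp only [translate, map_zero, map_sub, map_add, map_smul, smul_eq_mul]
    have e2 : (0 - (rePair T₀ v - t₀ * rePair T₀ v)) *
        (rePair T₀ (Λ i) + rePair T₀ v - (rePair T₀ v - t₀ * rePair T₀ v)) =
        -((1 - t₀) * (rePair T₀ v * (rePair T₀ (Λ i) + t₀ * rePair T₀ v))) := by ring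
    rw [e2, neg_lt_zero, mul_pos_iff_of_pos_left (sub_pos.2 ht1)]
  refine ⟨A, rePair T₀ v • T₀, t₀, 1 - t₀, ?_, ?_, ?_, ?_, ?_⟩
  · have hz : ∀ i, rePair (rePair T₀ v • T₀) (A i) = 0 ↔ rePair T₀ (A i) = 0 := fun i => by
      rw [rePair_smul, mul_eq_zero, or_iff_right hv]
    refine ⟨ht0, sub_pos.2 ht1, ?_, fun s hs hs0 => ?_, fun T' hT' => ?_, fun J hJ hJ0 i => ?_,
      w, fun i hi => hw i ((hz i).1 hi), fun i hi => hw' i (mt (hz i).2 hi), hw1, hws⟩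
    · rw [rePair_smul]
      exact mul_self_pos.2 hv
    · rw [htr]
      exact (hadm _ ⟨by linarith [hs.1], by linarith [hs.2]⟩).2 (by simpa using hs0)
    · obtain ⟨c, hc⟩ := hspan' T' fun i hi => hT' i ((hz i).2 hi)
      exact ⟨c / rePair T₀ v, by rw [smul_smul, div_mul_cancel₀ _ hv, hc]⟩
    · rw [hz, hiff J hJ hJ0]
  · rw [htr]
    ext i k
    simp [translate]
  · rw [htr, h.eq_translate]
    ext i k
    simp [translate]
  · ext i
    rw [hfar, mem_ofPred_eq, rePair_smul]
  · ext i
    rw [hfar', mem_ofPred_eq, rePair_smul]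

/-! ### The action on homogeneous coordinates and the topology of the leaf space -/

/-- The action of `(c, T) ∈ ℂˣ × ℂ^m` on homogeneous coordinates, whose orbits in the cone are
the points of the leaf space. -/
noncomputable def leafAct {m n : ℕ} (Λ : Fin n → Fin m → ℂ) (κ : ℂ × (Fin m → ℂ)) (z : Fin n → ℂ) :
    Fin n → ℂ :=
  fun i => κ.1 * (Complex.exp (Λ i ⬝ᵥ κ.2) * z i)

section Action

variable {m n : ℕ} {Λ : Fin n → Fin m → ℂ}

theorem proj_eq_iff {z w : cone Λ} :
    proj Λ z = proj Λ w ↔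
      ∃ κ : ℂ × (Fin m → ℂ), κ.1 ≠ 0 ∧ (w : Fin n → ℂ) = leafAct Λ κ z := by
  refine Quotient.eq.trans ⟨?_, ?_⟩
  · rintro ⟨c, T, hc, h⟩
    exact ⟨(c, T), hc, funext h⟩
  · rintro ⟨κ, hc, h⟩
    exact ⟨κ.1, κ.2, hc, fun i => congrFun h i⟩

theorem proj_surjective : Function.Surjective (proj Λ) := Quotient.mk_surjective

theorem continuous_proj : Continuous (proj Λ) := continuous_quotient_mk'

theorem leafAct_ne_zero_iff {κ : ℂ × (Fin m → ℂ)} (hκ : κ.1 ≠ 0) (z : Fin n → ℂ) (i : Fin n) :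
    leafAct Λ κ z i ≠ 0 ↔ z i ≠ 0 := by
  simp [leafAct, hκ, Complex.exp_ne_zero]

theorem leafAct_mem_cone {κ : ℂ × (Fin m → ℂ)} (hκ : κ.1 ≠ 0) {z : Fin n → ℂ} :
    leafAct Λ κ z ∈ cone Λ ↔ z ∈ cone Λ := by
  change (0 : Fin m → ℂ) ∈ convexHull ℝ (Λ '' {i | _ ≠ 0}) ↔ _
  simp_rw [leafAct_ne_zero_iff hκ]
  rfl

theorem norm_leafAct (κ : ℂ × (Fin m → ℂ)) (z : Fin n → ℂ) (i : Fin n) :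
    ‖leafAct Λ κ z i‖ = ‖κ.1‖ * (Real.exp (rePair κ.2 (Λ i)) * ‖z i‖) := by
  simp [leafAct, Complex.norm_exp, rePair_apply]

theorem continuous_leafAct :
    Continuous fun x : (ℂ × (Fin m → ℂ)) × (Fin n → ℂ) => leafAct Λ x.1 x.2 := by
  unfold leafAct
  simp only [dotProduct]
  fun_prop

theorem isOpenMap_proj : IsOpenMap (proj Λ) := by
  intro U hU
  have h : proj Λ ⁻¹' (proj Λ '' U) =
      ⋃ κ : {κ : ℂ × (Fin m → ℂ) // κ.1 ≠ 0},
        {z : cone Λ | (⟨leafAct Λ κ.1 z, (leafAct_mem_cone κ.2).2 z.2⟩ : cone Λ) ∈ U} := by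
    ext z
    simp only [mem_preimage, mem_image, mem_iUnion, mem_ofPred_eq]
    constructor
    · rintro ⟨w, hw, h⟩
      obtain ⟨κ, hκ, h⟩ := proj_eq_iff.1 h.symm
      exact ⟨⟨κ, hκ⟩, by convert hw; exact h.symm⟩
    · rintro ⟨κ, hκ⟩
      exact ⟨_, hκ, (proj_eq_iff.2 ⟨κ.1, κ.2, rfl⟩).symm⟩
  have hq : IsOpen (proj Λ ⁻¹' (proj Λ '' U)) := by
    rw [h]
    refine isOpen_iUnion fun κ => hU.preimage (Continuous.subtype_mk ?_ _)
    exact continuous_leafAct.comp (continuous_const.prodMk continuous_subtype_val)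
  exact isQuotientMap_quotient_mk'.isOpen_preimage.1 hq

theorem isOpenQuotientMap_proj : IsOpenQuotientMap (proj Λ) :=
  ⟨proj_surjective, continuous_proj, isOpenMap_proj⟩

/-- The action is free, up to the obvious identification of `c` with its logarithm. -/
theorem eq_of_leafAct_eq_self (hΛ : Admissible Λ) {z : Fin n → ℂ} (hz : z ∈ cone Λ)
    {κ : ℂ × (Fin m → ℂ)} (hκ : κ.1 ≠ 0) (h : leafAct Λ κ z = z) : κ = (1, 0) := by
  have hre : ∀ i, z i ≠ 0 → rePair κ.2 (Λ i) = -Real.log ‖κ.1‖ := by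
    intro i hi
    have h1 := norm_leafAct (Λ := Λ) κ z i
    rw [h] at h1
    have h2 : ‖κ.1‖ * Real.exp (rePair κ.2 (Λ i)) = 1 :=
      mul_right_cancel₀ (norm_ne_zero_iff.2 hi) (by rw [one_mul, mul_assoc]; exact h1.symm)
    have h3 := congrArg Real.log h2
    rw [Real.log_mul (norm_ne_zero_iff.2 hκ) (Real.exp_ne_zero _), Real.log_exp,
      Real.log_one] at h3
    linarith
  have hT : κ.2 = 0 := by
    by_contra hT
    obtain ⟨i, hi, hpos⟩ := hΛ.exists_rePair_pos hz hT
    obtain ⟨j, hj, hneg⟩ := hΛ.exists_rePair_pos hz (neg_ne_zero.2 hT)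
    rw [rePair_neg, hre j hj] at hneg
    rw [hre i hi] at hpos
    linarith
  obtain ⟨i, hi, -⟩ := exists_pos_of_mem_convexHull (0 : (Fin m → ℂ) →ₗ[ℝ] ℝ) hz
  have h1 := congrFun h i
  simp only [leafAct, hT, dotProduct_zero, Complex.exp_zero, one_mul] at h1
  exact Prod.ext (mul_right_cancel₀ hi (by simpa using h1)) hT

/-- The action is proper: the elements moving a point near `z₀` to a point near `z₁` belong to a
compact set. Indeed, a bound on the moduli of the coordinates of both points bounds `Re ⟨Λ i, T⟩`
from above for all `i` with `z₀ i ≠ 0`, and the origin is in the interior of the convex hull of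
these `Λ i`. -/
theorem exists_isCompact_of_leafAct_eq (hm : 0 < m) (hΛ : Admissible Λ) {z₀ z₁ : Fin n → ℂ}
    (h₀ : z₀ ∈ cone Λ) (h₁ : z₁ ∈ cone Λ) :
    ∃ K : Set (ℂ × (Fin m → ℂ)), IsCompact K ∧ (∀ κ ∈ K, κ.1 ≠ 0) ∧
      ∀ᶠ x : (Fin n → ℂ) × (Fin n → ℂ) in 𝓝 (z₀, z₁), ∀ κ : ℂ × (Fin m → ℂ), κ.1 ≠ 0 →
        x.2 = leafAct Λ κ x.1 → κ ∈ K := by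
  obtain ⟨ε, hε, hεT⟩ := exists_norm_le_rePair hm fun T hT => hΛ.exists_rePair_pos h₀ hT
  -- common bounds on the logarithms of the moduli near `z₀` and `z₁`
  have hlow : ∀ z : Fin n → ℂ, ∃ C : ℝ, ∀ᶠ w in 𝓝 z, ∀ i, z i ≠ 0 → Real.exp (-C) ≤ ‖w i‖ := by
    intro z
    have h : ∀ i, ∃ C : ℝ, z i ≠ 0 → Real.exp (-C) < ‖z i‖ := by
      intro i
      by_cases hi : z i = 0
      · exact ⟨0, fun h => (h hi).elim⟩
      · refine ⟨1 - Real.log ‖z i‖, fun _ => ?_⟩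
        calc Real.exp (-(1 - Real.log ‖z i‖)) < Real.exp (Real.log ‖z i‖) :=
              Real.exp_lt_exp.2 (by linarith)
          _ = _ := Real.exp_log (norm_pos_iff.2 hi)
    choose C hC using h
    refine ⟨∑ i, |C i|, ?_⟩
    rw [eventually_all]
    intro i
    by_cases hi : z i = 0
    · exact Eventually.of_forall fun _ h => (h hi).elim
    · have hlt : Real.exp (-∑ i, |C i|) < ‖z i‖ := by
        refine lt_of_le_of_lt (Real.exp_le_exp.2 (neg_le_neg ?_)) (hC i hi)
        exact (le_abs_self _).trans
          (Finset.single_le_sum (f := fun i => |C i|) (fun _ _ => abs_nonneg _) (Finset.mem_univ i))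
      have hc : Continuous fun w : Fin n → ℂ => ‖w i‖ := by fun_prop
      filter_upwards [hc.tendsto z (Ioi_mem_nhds hlt)] with w hw _ using le_of_lt hw
  have hup : ∀ z : Fin n → ℂ, ∃ C : ℝ, ∀ᶠ w in 𝓝 z, ∀ i, ‖w i‖ ≤ Real.exp C := by
    intro z
    refine ⟨‖z‖, ?_⟩
    have hlt : ‖z‖ < Real.exp ‖z‖ := by linarith [Real.add_one_le_exp ‖z‖]
    filter_upwards [continuous_norm.tendsto z (Iio_mem_nhds hlt)] with w hw i
    exact (norm_le_pi_norm w i).trans (le_of_lt hw)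
  obtain ⟨C₀, hC₀⟩ := hlow z₀
  obtain ⟨C₁, hC₁⟩ := hlow z₁
  obtain ⟨D₀, hD₀⟩ := hup z₀
  obtain ⟨D₁, hD₁⟩ := hup z₁
  set R : ℝ := max (C₀ + D₁) (C₁ + D₀) with hR
  refine ⟨(Metric.closedBall 0 (Real.exp R) ∩ {c | Real.exp (-R) ≤ ‖c‖}) ×ˢ
    Metric.closedBall 0 (2 * R / ε), ?_, ?_, ?_⟩
  · refine IsCompact.prod ?_ (isCompact_closedBall _ _)
    exact (isCompact_closedBall _ _).inter_right (isClosed_le continuous_const continuous_norm)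
  · rintro ⟨c, T⟩ ⟨⟨-, hc⟩, -⟩ rfl
    have hc' : Real.exp (-R) ≤ ‖(0 : ℂ)‖ := hc
    rw [norm_zero] at hc'
    exact hc'.not_gt (Real.exp_pos _)
  · filter_upwards [(hC₀.and hD₀).prod_nhds (hC₁.and hD₁)] with x hx κ hκ hact
    obtain ⟨⟨hx1, hx2⟩, hx3, hx4⟩ := hx
    have hκ' : 0 < ‖κ.1‖ := norm_pos_iff.2 hκ
    set r := Real.log ‖κ.1‖ with hr
    have hnorm : ∀ i, ‖x.2 i‖ = Real.exp (r + rePair κ.2 (Λ i)) * ‖x.1 i‖ := fun i => by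
      rw [hact, norm_leafAct, Real.exp_add, hr, Real.exp_log hκ', mul_assoc]
    have hle : ∀ i, z₀ i ≠ 0 → r + rePair κ.2 (Λ i) ≤ R := by
      intro i hi
      refine le_trans ?_ (le_max_left _ _)
      have h1 : Real.exp (r + rePair κ.2 (Λ i)) * Real.exp (-C₀) ≤ Real.exp D₁ := by
        refine le_trans ?_ (hx4 i)
        rw [hnorm]
        gcongr
        exact hx1 i hi
      rw [← Real.exp_add, Real.exp_le_exp] at h1
      linarith
    have hge : ∀ i, z₁ i ≠ 0 → -R ≤ r + rePair κ.2 (Λ i) := by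
      intro i hi
      have h1 : Real.exp (-C₁) ≤ Real.exp (r + rePair κ.2 (Λ i)) * Real.exp D₀ := by
        refine (hx3 i hi).trans ?_
        rw [hnorm]
        gcongr
        exact hx2 i
      rw [← Real.exp_add, Real.exp_le_exp] at h1
      have := le_max_right (C₀ + D₁) (C₁ + D₀)
      linarith
    obtain ⟨i, hi, hi'⟩ := exists_pos_of_mem_convexHull (rePair κ.2) h₀
    obtain ⟨j, hj, hj'⟩ := exists_pos_of_mem_convexHull (rePair (-κ.2)) h₁
    obtain ⟨k, hk, hk'⟩ := hεT κ.2
    rw [map_zero] at hi' hj'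
    rw [rePair_neg] at hj'
    have e1 := hle i hi
    have e2 := hge j hj
    have e3 := hle k hk
    have hr1 : r ≤ R := by linarith
    have hr2 : -R ≤ r := by linarith
    refine ⟨⟨?_, ?_⟩, ?_⟩
    · rw [mem_closedBall_zero_iff, ← Real.exp_log hκ']
      exact Real.exp_le_exp.2 hr1
    · change Real.exp (-R) ≤ ‖κ.1‖
      rw [← Real.exp_log hκ']
      exact Real.exp_le_exp.2 hr2
    · rw [mem_closedBall_zero_iff, le_div_iff₀ hε]
      linarith

/-- A compact set of group elements, none of which moves `z₀` to `z₁`, moves no point near `z₀` to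
a point near `z₁`. -/
theorem eventually_leafAct_ne {K : Set (ℂ × (Fin m → ℂ))} (hK : IsCompact K) {z₀ z₁ : Fin n → ℂ}
    (h : ∀ κ ∈ K, z₁ ≠ leafAct Λ κ z₀) :
    ∀ᶠ x : (Fin n → ℂ) × (Fin n → ℂ) in 𝓝 (z₀, z₁), ∀ κ ∈ K, x.2 ≠ leafAct Λ κ x.1 := by
  have hcont : Continuous fun y : (ℂ × (Fin m → ℂ)) × (Fin n → ℂ) × (Fin n → ℂ) =>
      leafAct Λ y.1 y.2.1 :=
    continuous_leafAct.comp (continuous_fst.prodMk continuous_snd.fst)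
  have hopen : IsOpen {y : (ℂ × (Fin m → ℂ)) × (Fin n → ℂ) × (Fin n → ℂ) |
      y.2.2 ≠ leafAct Λ y.1 y.2.1} := isOpen_ne_fun continuous_snd.snd hcont
  obtain ⟨u, v, -, hv, hKu, hxv, huv⟩ := generalized_tube_lemma hK
    (isCompact_singleton (x := (z₀, z₁))) hopen (by
      rintro ⟨κ, x⟩ ⟨hκ, hx⟩
      rw [mem_singleton_iff] at hx
      subst hx
      exact h κ hκ)
  filter_upwards [hv.mem_nhds (hxv rfl)] with x hx κ hκ
  exact @huv (κ, x) ⟨hKu hκ, hx⟩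

theorem t2Space_N (hm : 0 < m) (hΛ : Admissible Λ) : T2Space (N Λ) := by
  rw [t2Space_iff_of_isOpenQuotientMap isOpenQuotientMap_proj, ← isOpen_compl_iff,
    isOpen_iff_mem_nhds]
  rintro ⟨z, w⟩ hzw
  obtain ⟨K, hK, hK0, hKev⟩ := exists_isCompact_of_leafAct_eq hm hΛ z.2 w.2
  have hne : ∀ κ ∈ K, (w : Fin n → ℂ) ≠ leafAct Λ κ z := fun κ hκ h =>
    hzw (proj_eq_iff.2 ⟨κ, hK0 κ hκ, h⟩)
  have hcont : Continuous fun x : cone Λ × cone Λ => ((x.1 : Fin n → ℂ), (x.2 : Fin n → ℂ)) := by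
    fun_prop
  filter_upwards [hcont.tendsto (z, w) (hKev.and (eventually_leafAct_ne hK hne))] with x hx hxe
  obtain ⟨κ, hκ, h⟩ := proj_eq_iff.1 hxe
  exact hx.2 κ (hx.1 κ hκ h) h

/-- Every leaf has a point with `∑ |z i|² Λ i = 0`: the squared norm of `exp ⟨Λ, T⟩ z` is a proper
function of `T`, and this equation expresses that its minimum is a critical point. -/
theorem exists_leafAct_sum_eq_zero (hm : 0 < m) (hΛ : Admissible Λ) {z : Fin n → ℂ}
    (hz : z ∈ cone Λ) :
    ∃ T : Fin m → ℂ, ∑ i, (‖leafAct Λ (1, T) z i‖ ^ 2) • Λ i = 0 := by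
  obtain ⟨ε, hε, hεT⟩ := exists_norm_le_rePair hm fun T hT => hΛ.exists_rePair_pos hz hT
  set F : (Fin m → ℂ) → ℝ := fun T => ∑ i, ‖z i‖ ^ 2 * Real.exp (2 * rePair T (Λ i)) with hF
  have hcont : Continuous F :=
    continuous_finsetSum _ fun i _ =>
      continuous_const.mul (Real.continuous_exp.comp (continuous_const.mul (continuous_rePair _)))
  obtain ⟨δ, hδ, hδz⟩ : ∃ δ > 0, ∀ i, z i ≠ 0 → δ ≤ ‖z i‖ ^ 2 := by
    classical
    have hne : (Finset.univ.filter fun i => z i ≠ 0).Nonempty := by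
      obtain ⟨i, hi, -⟩ := hεT 0
      exact ⟨i, by simpa using hi⟩
    obtain ⟨i, hi, hmin⟩ := Finset.exists_min_image _ (fun i => ‖z i‖ ^ 2) hne
    exact ⟨‖z i‖ ^ 2, by have := (Finset.mem_filter.1 hi).2; positivity,
      fun j hj => hmin j (by simpa using hj)⟩
  have hlim : Tendsto F (cocompact _) atTop := by
    have hbound : ∀ T, δ * (2 * (ε * ‖T‖)) ≤ F T := by
      intro T
      obtain ⟨i, hi, hle⟩ := hεT T
      calc δ * (2 * (ε * ‖T‖)) ≤ ‖z i‖ ^ 2 * Real.exp (2 * rePair T (Λ i)) := by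
            refine mul_le_mul (hδz i hi) ?_ (by positivity) (by positivity)
            have := Real.add_one_le_exp (2 * rePair T (Λ i))
            linarith
        _ ≤ F T := Finset.single_le_sum (f := fun i => ‖z i‖ ^ 2 * Real.exp (2 * rePair T (Λ i)))
            (fun _ _ => by positivity) (Finset.mem_univ i)
    refine tendsto_atTop_mono hbound ?_
    exact (((tendsto_norm_cocompact_atTop (E := Fin m → ℂ)).const_mul_atTop hε).const_mul_atTop
      two_pos).const_mul_atTop hδ
  have : Nonempty (Fin m → ℂ) := ⟨0⟩
  obtain ⟨T₀, hT₀⟩ := hcont.exists_forall_le hlim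
  refine ⟨T₀, ?_⟩
  set b : Fin n → ℝ := fun i => ‖z i‖ ^ 2 * Real.exp (2 * rePair T₀ (Λ i)) with hb
  have hb' : ∀ i, ‖leafAct Λ (1, T₀) z i‖ ^ 2 = b i := fun i => by
    rw [norm_leafAct, hb, norm_one, one_mul, mul_pow, ← Real.exp_nat_mul]
    push_cast
    ring
  simp_rw [hb']
  have hcrit : ∀ T, rePair T (∑ i, b i • Λ i) = 0 := by
    intro T
    have hline : ∀ t : ℝ, F (T₀ + t • T) = ∑ i, b i * Real.exp (2 * (t * rePair T (Λ i))) := by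
      intro t
      refine Finset.sum_congr rfl fun i _ => ?_
      have : rePair (T₀ + t • T) (Λ i) = rePair T₀ (Λ i) + t * rePair T (Λ i) := by
        rw [← rePair_smul]
        simp [rePair_apply, dotProduct_add]
      rw [this, mul_add, Real.exp_add, mul_assoc]
    have hder : HasDerivAt (fun t : ℝ => F (T₀ + t • T))
        (∑ i, b i * (Real.exp (2 * (0 * rePair T (Λ i))) * (2 * (1 * rePair T (Λ i))))) 0 := by
      simp_rw [hline]
      refine HasDerivAt.fun_sum fun i _ => ?_
      exact ((((hasDerivAt_id (0 : ℝ)).mul_const _).const_mul 2).exp).const_mul (b i)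
    have hmin : IsLocalMin (fun t : ℝ => F (T₀ + t • T)) 0 :=
      Eventually.of_forall fun t => by simpa using hT₀ (T₀ + t • T)
    have h0 := hmin.hasDerivAt_eq_zero hder
    simp only [zero_mul, mul_zero, Real.exp_zero, one_mul] at h0
    rw [map_sum]
    simp only [map_smul, smul_eq_mul]
    have : 2 * ∑ i, b i * rePair T (Λ i) = 0 := by
      rw [← h0, Finset.mul_sum]
      exact Finset.sum_congr rfl fun i _ => by ring
    linarith
  -- the pairing is nondegenerate
  by_contra hne
  have h1 : rePair (∑ i, b i • Λ i) ≠ 0 := rePair_ne_zero hne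
  refine h1 (LinearMap.ext fun T => ?_)
  have := hcrit T
  rw [rePair_apply, dotProduct_comm] at this
  simpa [rePair_apply] using this

theorem compactSpace_N (hm : 0 < m) (hΛ : Admissible Λ) : CompactSpace (N Λ) := by
  set M : Set (Fin n → ℂ) := {z | ∑ i, ‖z i‖ ^ 2 = 1 ∧ ∑ i, (‖z i‖ ^ 2) • Λ i = 0} with hM
  have hMc : IsCompact M := by
    refine Metric.isCompact_of_isClosed_isBounded ?_ ?_
    · exact (isClosed_eq (by fun_prop) continuous_const).inter
        (isClosed_eq (by fun_prop) continuous_const)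
    · refine (Metric.isBounded_closedBall (x := (0 : Fin n → ℂ)) (r := 1)).subset ?_
      rintro z ⟨hz, -⟩
      rw [mem_closedBall_zero_iff, pi_norm_le_iff_of_nonneg zero_le_one]
      intro i
      have : ‖z i‖ ^ 2 ≤ 1 := by
        rw [← hz]
        exact Finset.single_le_sum (f := fun i => ‖z i‖ ^ 2) (fun _ _ => by positivity)
          (Finset.mem_univ i)
      exact (sq_le_one_iff₀ (norm_nonneg _)).1 this
  have hMcone : ∀ z ∈ M, z ∈ cone Λ := by
    rintro z ⟨h1, h2⟩
    exact mem_convexHull_image_of_sum (w := fun i => ‖z i‖ ^ 2) (fun _ => by positivity)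
      (fun i hi => by simpa using hi) h1 h2
  have hMc' : IsCompact ((↑) ⁻¹' M : Set (cone Λ)) := by
    rw [Subtype.isCompact_iff]
    convert hMc
    exact Subtype.image_preimage_coe _ _ |>.trans (inter_eq_right.2 hMcone)
  refine ⟨?_⟩
  convert hMc'.image continuous_proj
  symm
  refine eq_univ_of_forall fun p => ?_
  obtain ⟨z, rfl⟩ := proj_surjective p
  obtain ⟨T, hT⟩ := exists_leafAct_sum_eq_zero hm hΛ z.2
  have hw : leafAct Λ (1, T) z ∈ cone Λ := (leafAct_mem_cone one_ne_zero).2 z.2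
  set s : ℝ := ∑ i, ‖leafAct Λ (1, T) z i‖ ^ 2 with hs
  have hs0 : 0 < s := by
    obtain ⟨i, hi, -⟩ := exists_pos_of_mem_convexHull (0 : (Fin m → ℂ) →ₗ[ℝ] ℝ) hw
    refine Finset.sum_pos' (fun _ _ => by positivity) ⟨i, Finset.mem_univ i, ?_⟩
    have : ‖leafAct Λ (1, T) z i‖ ≠ 0 := norm_ne_zero_iff.2 hi
    positivity
  -- rescale the point to norm one
  have hc : ((√s)⁻¹ : ℂ) ≠ 0 := by
    simpa using (Real.sqrt_pos.2 hs0).ne'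
  have hnorm : ∀ i, ‖leafAct Λ ((√s)⁻¹, T) z i‖ ^ 2 = s⁻¹ * ‖leafAct Λ (1, T) z i‖ ^ 2 := by
    intro i
    rw [norm_leafAct, norm_leafAct, mul_pow, norm_one, one_mul, norm_inv, Complex.norm_real,
      Real.norm_of_nonneg (Real.sqrt_nonneg _), inv_pow, Real.sq_sqrt hs0.le]
  refine ⟨⟨leafAct Λ ((√s)⁻¹, T) z, (leafAct_mem_cone hc).2 z.2⟩, ⟨?_, ?_⟩,
    (proj_eq_iff.2 ⟨_, hc, rfl⟩).symm⟩
  · simp_rw [hnorm]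
    rw [← Finset.mul_sum, ← hs, inv_mul_cancel₀ hs0.ne']
  · simp_rw [hnorm, mul_smul]
    rw [← Finset.smul_sum, hT, smul_zero]

end Action

/-! ### Local slices of the action -/

/-- A frame at `z₀`: a splitting `σ` of the coordinates into `m + 1` coordinates not vanishing at
`z₀` and the `n - m - 1` others, such that the linear map giving the logarithms of the factors by
which the action multiplies the coordinates of the first group is an isomorphism. -/
structure Frame {m n : ℕ} (Λ : Fin n → Fin m → ℂ) (z₀ : Fin n → ℂ) where
  /-- the splitting of the coordinates -/
  σ : Fin (m + 1) ⊕ Fin (n - m - 1) ≃ Fin n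
  /-- the logarithms of the factors, as coordinates on the Lie algebra `ℂ × ℂ^m` -/
  L : (ℂ × (Fin m → ℂ)) ≃L[ℂ] (Fin (m + 1) → ℂ)
  L_apply : ∀ κ j, L κ j = κ.1 + Λ (σ (Sum.inl j)) ⬝ᵥ κ.2
  ne_zero : ∀ j, z₀ (σ (Sum.inl j)) ≠ 0

/-- The functionals `(s, T) ↦ s + ⟨Λ i, T⟩` with `z₀ i ≠ 0` have no common zero, hence a basis of
the dual space can be chosen among them. -/
theorem nonempty_frame {m n : ℕ} {Λ : Fin n → Fin m → ℂ} (hΛ : Admissible Λ) {z₀ : Fin n → ℂ}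
    (hz₀ : z₀ ∈ cone Λ) : Nonempty (Frame Λ z₀) := by
  classical
  let l : {i // z₀ i ≠ 0} → Module.Dual ℂ (ℂ × (Fin m → ℂ)) := fun i =>
    { toFun := fun κ => κ.1 + Λ i ⬝ᵥ κ.2
      map_add' := fun x y => by simp [dotProduct_add]; ring
      map_smul' := fun c x => by simp [dotProduct_smul, mul_add] }
  have hl : ∀ i κ, l i κ = κ.1 + Λ i ⬝ᵥ κ.2 := fun _ _ => rfl
  have hker : ∀ κ, (∀ i, l i κ = 0) → κ = 0 := by
    intro κ hκ
    have hre : ∀ i, z₀ i ≠ 0 → rePair κ.2 (Λ i) = -κ.1.re := fun i hi => by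
      have := congrArg Complex.re (hκ ⟨i, hi⟩)
      rw [hl, Complex.add_re, Complex.zero_re] at this
      rw [rePair_apply]
      linarith
    have hT : κ.2 = 0 := by
      by_contra hT
      obtain ⟨i, hi, hpos⟩ := hΛ.exists_rePair_pos hz₀ hT
      obtain ⟨j, hj, hneg⟩ := hΛ.exists_rePair_pos hz₀ (neg_ne_zero.2 hT)
      rw [rePair_neg, hre j hj] at hneg
      rw [hre i hi] at hpos
      linarith
    obtain ⟨i, hi, -⟩ := exists_pos_of_mem_convexHull (0 : (Fin m → ℂ) →ₗ[ℝ] ℝ) hz₀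
    have h1 := hκ ⟨i, hi⟩
    rw [hl, hT, dotProduct_zero, add_zero] at h1
    exact Prod.ext h1 hT
  obtain ⟨ι, a, ha, hspan, hind⟩ := exists_linearIndependent' ℂ l
  have htop : Submodule.span ℂ (range (l ∘ a)) = ⊤ := by
    rw [hspan, eq_top_iff]
    intro K _
    refine mem_span_of_iInf_ker_le_ker fun κ hκ => ?_
    simp only [Submodule.mem_iInf, LinearMap.mem_ker] at hκ
    rw [hker κ hκ]
    exact Submodule.zero_mem _
  have : Finite ι := Finite.of_injective a ha
  have : Fintype ι := Fintype.ofFinite ι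
  have hfin : Module.finrank ℂ (ℂ × (Fin m → ℂ)) = m + 1 := by simp [add_comm]
  have hcard : Fintype.card ι = m + 1 := by
    rw [← Module.finrank_eq_card_basis (Module.Basis.mk hind htop.ge), Subspace.dual_finrank_eq,
      hfin]
  let e₁ : Fin (m + 1) ≃ ι := (Fintype.equivFinOfCardEq hcard).symm
  let b : Fin (m + 1) → Fin n := fun j => (a (e₁ j) : Fin n)
  have hb : Function.Injective b := Subtype.val_injective.comp (ha.comp e₁.injective)
  have hcompl : Fintype.card ((range b)ᶜ : Set (Fin n)) = n - m - 1 := by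
    rw [Fintype.card_compl_set, Set.card_range_of_injective hb, Fintype.card_fin, Fintype.card_fin,
      Nat.sub_sub]
  let σ : Fin (m + 1) ⊕ Fin (n - m - 1) ≃ Fin n :=
    (Equiv.sumCongr (Equiv.ofInjective b hb) (Fintype.equivFinOfCardEq hcompl).symm).trans
      (Equiv.Set.sumCompl (range b))
  have hσ : ∀ j, σ (Sum.inl j) = b j := fun j => rfl
  let f : (ℂ × (Fin m → ℂ)) →ₗ[ℂ] (Fin (m + 1) → ℂ) := LinearMap.pi fun j => l (a (e₁ j))
  have hf : Function.Injective f := by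
    rw [← LinearMap.ker_eq_bot, LinearMap.ker_eq_bot']
    intro κ hκ
    refine hker κ fun i => ?_
    have hmem : l i ∈ Submodule.span ℂ (range (l ∘ a)) := htop ▸ Submodule.mem_top
    have hle : Submodule.span ℂ (range (l ∘ a)) ≤
        LinearMap.ker (Module.Dual.eval ℂ (ℂ × (Fin m → ℂ)) κ) := by
      rw [Submodule.span_le]
      rintro _ ⟨k, rfl⟩
      have := congrFun hκ (e₁.symm k)
      simpa [f] using this
    exact hle hmem
  exact ⟨⟨σ, (LinearMap.linearEquivOfInjective f hf (by rw [hfin]; simp)).toContinuousLinearEquiv,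
    fun κ j => rfl, fun j => (a (e₁ j)).2⟩⟩

namespace Frame

variable {m n : ℕ} {Λ : Fin n → Fin m → ℂ} {z₀ : Fin n → ℂ} (F : Frame Λ z₀)

/-- The slice through `z₀`: the points with the same coordinates as `z₀` in the first group. -/
def slice (y : Model n m) : Fin n → ℂ :=
  fun i => Sum.elim (fun j => z₀ (F.σ (Sum.inl j))) y (F.σ.symm i)

/-- The coordinates of `z` in the second group. -/
def rest (z : Fin n → ℂ) : Model n m := fun k => z (F.σ (Sum.inr k))

/-- The logarithms of the coordinates of `z` in the first group, relative to those of `z₀`. -/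
noncomputable def logs (z : Fin n → ℂ) : Fin (m + 1) → ℂ :=
  fun j => Complex.log (z (F.σ (Sum.inl j)) / z₀ (F.σ (Sum.inl j)))

theorem rest_apply (z : Fin n → ℂ) (k : Fin (n - m - 1)) : F.rest z k = z (F.σ (Sum.inr k)) :=
  rfl

theorem logs_apply (z : Fin n → ℂ) (j : Fin (m + 1)) :
    F.logs z j = Complex.log (z (F.σ (Sum.inl j)) / z₀ (F.σ (Sum.inl j))) := rfl

@[simp]
theorem slice_inl (y : Model n m) (j : Fin (m + 1)) :
    F.slice y (F.σ (Sum.inl j)) = z₀ (F.σ (Sum.inl j)) := by simp [slice]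

@[simp]
theorem slice_inr (y : Model n m) (k : Fin (n - m - 1)) : F.slice y (F.σ (Sum.inr k)) = y k := by
  simp [slice]

theorem slice_rest : F.slice (F.rest z₀) = z₀ := by
  ext i
  obtain ⟨i, rfl⟩ := F.σ.surjective i
  rcases i with j | k <;> simp [rest]

theorem contDiff_slice : ContDiff ℂ ω F.slice := by
  refine contDiff_pi.2 fun i => ?_
  obtain ⟨i, rfl⟩ := F.σ.surjective i
  rcases i with j | k
  · simpa using contDiff_const
  · simpa using contDiff_apply ℂ ℂ k

end Frame

/-- The action of the Lie algebra through the exponential map. -/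
noncomputable def expAct {m n : ℕ} (Λ : Fin n → Fin m → ℂ) (κ : ℂ × (Fin m → ℂ))
    (z : Fin n → ℂ) : Fin n → ℂ :=
  leafAct Λ (Complex.exp κ.1, κ.2) z

theorem expAct_apply {m n : ℕ} (Λ : Fin n → Fin m → ℂ) (κ : ℂ × (Fin m → ℂ)) (z : Fin n → ℂ)
    (i : Fin n) : expAct Λ κ z i = Complex.exp (κ.1 + Λ i ⬝ᵥ κ.2) * z i := by
  simp [expAct, leafAct, Complex.exp_add, mul_assoc]

theorem contDiff_expAct {m n : ℕ} (Λ : Fin n → Fin m → ℂ) :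
    ContDiff ℂ ω fun x : (ℂ × (Fin m → ℂ)) × (Fin n → ℂ) => expAct Λ x.1 x.2 := by
  refine contDiff_pi.2 fun i => ?_
  simp_rw [expAct_apply]
  simp only [dotProduct]
  fun_prop

namespace Frame

variable {m n : ℕ} {Λ : Fin n → Fin m → ℂ} {z₀ : Fin n → ℂ} (F : Frame Λ z₀)

theorem expAct_inl (κ : ℂ × (Fin m → ℂ)) (z : Fin n → ℂ) (j : Fin (m + 1)) :
    expAct Λ κ z (F.σ (Sum.inl j)) = Complex.exp (F.L κ j) * z (F.σ (Sum.inl j)) := by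
  rw [expAct_apply, F.L_apply]

theorem logs_slice (y : Model n m) : F.logs (F.slice y) = 0 := by
  ext j
  simp [logs, div_self (F.ne_zero j)]

theorem contDiffAt_logs {z : Fin n → ℂ}
    (hz : ∀ j, z (F.σ (Sum.inl j)) / z₀ (F.σ (Sum.inl j)) ∈ Complex.slitPlane) :
    ContDiffAt ℂ ω F.logs z := by
  refine contDiffAt_pi.2 fun j => ?_
  refine (Complex.contDiffAt_log (hz j)).comp z ?_
  exact ((contDiff_apply ℂ ℂ (F.σ (Sum.inl j))).div_const _).contDiffAt

/-- The coordinates near `z₀` adapted to the action: a point is written as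
`exp κ • slice y`, and sent to `(y, L κ)`. -/
noncomputable def straighten :
    OpenPartialHomeomorph (Fin n → ℂ) (Model n m × (Fin (m + 1) → ℂ)) where
  toFun z := (F.rest (expAct Λ (-F.L.symm (F.logs z)) z), F.logs z)
  invFun x := expAct Λ (F.L.symm x.2) (F.slice x.1)
  source := {z | ∀ j, z (F.σ (Sum.inl j)) / z₀ (F.σ (Sum.inl j)) ∈ Complex.slitPlane}
  target := {x | ∀ j, (x.2 j).im ∈ Ioo (-Real.pi) Real.pi}
  map_source' z hz j := by
    have := Complex.expOpenPartialHomeomorph.map_target (hz j)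
    exact this
  map_target' x hx j := by
    rw [expAct_inl, slice_inl, mul_div_cancel_right₀ _ (F.ne_zero j),
      ContinuousLinearEquiv.apply_symm_apply]
    exact Complex.expOpenPartialHomeomorph.map_source (hx j)
  left_inv' z hz := by
    ext i
    obtain ⟨i, rfl⟩ := F.σ.surjective i
    rcases i with j | k
    · dsimp only
      rw [expAct_inl, slice_inl, ContinuousLinearEquiv.apply_symm_apply, logs_apply,
        Complex.exp_log (Complex.slitPlane_ne_zero (hz j)), div_mul_cancel₀ _ (F.ne_zero j)]
    · dsimp only
      rw [expAct_apply, slice_inr, rest_apply, expAct_apply, ← mul_assoc, ← Complex.exp_add,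
        Prod.fst_neg, Prod.snd_neg, dotProduct_neg, ← neg_add, add_neg_cancel, Complex.exp_zero,
        one_mul]
  right_inv' x hx := by
    have hlogs : F.logs (expAct Λ (F.L.symm x.2) (F.slice x.1)) = x.2 := by
      ext j
      rw [logs_apply, expAct_inl, slice_inl, mul_div_cancel_right₀ _ (F.ne_zero j),
        ContinuousLinearEquiv.apply_symm_apply, Complex.log_exp (hx j).1 (hx j).2.le]
    refine Prod.ext ?_ hlogs
    ext k
    simp only [hlogs]
    rw [rest_apply, expAct_apply, expAct_apply, slice_inr, ← mul_assoc, ← Complex.exp_add,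
      Prod.fst_neg, Prod.snd_neg, dotProduct_neg, ← neg_add, neg_add_cancel, Complex.exp_zero,
      one_mul]
  open_source := by
    simp only [ofPred_forall]
    exact isOpen_iInter_of_finite fun j => Complex.isOpen_slitPlane.preimage (by fun_prop)
  open_target := by
    simp only [ofPred_forall]
    exact isOpen_iInter_of_finite fun j => isOpen_Ioo.preimage (by fun_prop)
  continuousOn_toFun := by
    intro z hz
    have h1 := (F.contDiffAt_logs hz).continuousAt
    refine ContinuousAt.continuousWithinAt (ContinuousAt.prodMk ?_ h1)
    have h2 : ContinuousAt (fun z => expAct Λ (-F.L.symm (F.logs z)) z) z :=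
      (contDiff_expAct Λ).continuous.continuousAt.comp
        (((F.L.symm.continuous.continuousAt.comp h1).neg).prodMk continuousAt_id)
    exact continuousAt_pi.2 fun k => (continuous_apply (F.σ (Sum.inr k))).continuousAt.comp h2
  continuousOn_invFun := by
    refine Continuous.continuousOn ?_
    exact (contDiff_expAct Λ).continuous.comp
      ((F.L.symm.continuous.comp continuous_snd).prodMk
        (F.contDiff_slice.continuous.comp continuous_fst))

theorem contDiffOn_straighten : ContDiffOn ℂ ω F.straighten F.straighten.source := by
  intro z hz
  have h1 := F.contDiffAt_logs hz
  refine ContDiffAt.contDiffWithinAt (ContDiffAt.prodMk ?_ h1)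
  have h2 : ContDiffAt ℂ ω (fun z => expAct Λ (-F.L.symm (F.logs z)) z) z :=
    (contDiff_expAct Λ).contDiffAt.comp z
      (((F.L.symm.contDiff.contDiffAt.comp z h1).neg).prodMk contDiffAt_id)
  exact contDiffAt_pi.2 fun k => (contDiff_apply ℂ ℂ (F.σ (Sum.inr k))).contDiffAt.comp z h2

theorem contDiff_straighten_symm : ContDiff ℂ ω F.straighten.symm :=
  (contDiff_expAct Λ).comp ((F.L.symm.contDiff.comp contDiff_snd).prodMk
    (F.contDiff_slice.comp contDiff_fst))

theorem slice_mem_straighten_source (y : Model n m) : F.slice y ∈ F.straighten.source := by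
  intro j
  rw [slice_inl, div_self (F.ne_zero j)]
  exact Complex.one_mem_slitPlane

theorem straighten_slice (y : Model n m) : F.straighten (F.slice y) = (y, 0) := by
  refine Prod.ext ?_ (F.logs_slice y)
  ext k
  change expAct Λ (-F.L.symm (F.logs (F.slice y))) (F.slice y) (F.σ (Sum.inr k)) = y k
  rw [logs_slice, expAct_apply]
  simp

theorem eq_expAct_slice {z : Fin n → ℂ} (hz : z ∈ F.straighten.source) :
    z = expAct Λ (F.L.symm (F.straighten z).2) (F.slice (F.straighten z).1) :=
  (F.straighten.left_inv hz).symm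

/-- Near `z₀`, the slice meets every orbit at most once. A group element relating two points of
the slice close to `z₀` belongs to a fixed compact set and almost fixes `z₀`, so that it is close
to the identity because the action is free; but the isomorphism `L` shows that no element close to
the identity preserves the coordinates of the first group. -/
theorem exists_isOpen_slice_injOn (hm : 0 < m) (hΛ : Admissible Λ) (hz₀ : z₀ ∈ cone Λ) :
    ∃ O : Set (Model n m), IsOpen O ∧ F.rest z₀ ∈ O ∧ (∀ y ∈ O, F.slice y ∈ cone Λ) ∧
      ∀ y ∈ O, ∀ y' ∈ O, ∀ κ : ℂ × (Fin m → ℂ), κ.1 ≠ 0 →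
        F.slice y' = leafAct Λ κ (F.slice y) → y' = y := by
  obtain ⟨K, hK, hK0, hKev⟩ := exists_isCompact_of_leafAct_eq hm hΛ hz₀ hz₀
  -- the elements for which the logarithms of the factors on the first group are small
  set D : Set (ℂ × (Fin m → ℂ)) := {κ | κ.1 ∈ Complex.slitPlane ∧
    ∀ j, (F.L (Complex.log κ.1, κ.2) j).im ∈ Ioo (-Real.pi) Real.pi} with hD
  have hD1 : D ∈ 𝓝 ((1 : ℂ), (0 : Fin m → ℂ)) := by
    have hlog : ContinuousAt (fun κ : ℂ × (Fin m → ℂ) => (Complex.log κ.1, κ.2)) (1, 0) :=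
      (continuousAt_fst.clog Complex.one_mem_slitPlane).prodMk continuousAt_snd
    refine Filter.inter_mem ?_ ?_
    · exact continuousAt_fst.preimage_mem_nhds
        (Complex.isOpen_slitPlane.mem_nhds Complex.one_mem_slitPlane)
    · refine (eventually_all (l := 𝓝 ((1 : ℂ), (0 : Fin m → ℂ)))).2 fun j => ?_
      have hc : ContinuousAt
          (fun κ : ℂ × (Fin m → ℂ) => (F.L (Complex.log κ.1, κ.2) j).im) (1, 0) :=
        Complex.continuous_im.continuousAt.comp ((continuous_apply j).continuousAt.comp
          (F.L.continuous.continuousAt.comp hlog))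
      refine hc.preimage_mem_nhds (Ioo_mem_nhds ?_ ?_)
      all_goals
        have : F.L (Complex.log 1, (0 : Fin m → ℂ)) = 0 := by
          rw [Complex.log_one]
          exact map_zero F.L
        rw [this]
        simp [Real.pi_pos]
  have hKD : IsCompact (K \ interior D) := hK.diff isOpen_interior
  have hne : ∀ κ ∈ K \ interior D, z₀ ≠ leafAct Λ κ z₀ := fun κ hκ h => by
    have := eq_of_leafAct_eq_self hΛ hz₀ (hK0 κ hκ.1) h.symm
    exact hκ.2 (this ▸ mem_interior_iff_mem_nhds.2 hD1)
  have hev := hKev.and (eventually_leafAct_ne hKD hne)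
  have hcont : ContinuousAt (fun x : Model n m × Model n m => (F.slice x.1, F.slice x.2))
      (F.rest z₀, F.rest z₀) :=
    ((F.contDiff_slice.continuous.comp continuous_fst).prodMk
      (F.contDiff_slice.continuous.comp continuous_snd)).continuousAt
  have hlim := hcont.tendsto
  simp only [slice_rest] at hlim
  obtain ⟨u, hu, v, hv, huv⟩ := mem_nhds_prod_iff.1 (hlim hev)
  have hcone : {y | F.slice y ∈ cone Λ} ∈ 𝓝 (F.rest z₀) := by
    refine F.contDiff_slice.continuous.continuousAt.preimage_mem_nhds ((cone Λ).2.mem_nhds ?_)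
    rw [slice_rest]
    exact hz₀
  refine ⟨interior (u ∩ v ∩ {y | F.slice y ∈ cone Λ}), isOpen_interior,
    mem_interior_iff_mem_nhds.2 (inter_mem (inter_mem hu hv) hcone),
    fun y hy => (interior_subset hy).2, ?_⟩
  intro y hy y' hy' κ hκ hyy'
  have hyu := interior_subset hy
  have hyv := interior_subset hy'
  obtain ⟨h1, h2⟩ := huv (show (y, y') ∈ u ×ˢ v from ⟨hyu.1.1, hyv.1.2⟩)
  have hκD : κ ∈ D := by
    by_contra hκD
    exact h2 κ ⟨h1 κ hκ hyy', fun h => hκD (interior_subset h)⟩ hyy'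
  have hL : F.L (Complex.log κ.1, κ.2) = 0 := by
    ext j
    have h3 := congrFun hyy' (F.σ (Sum.inl j))
    have h4 : leafAct Λ κ (F.slice y) = expAct Λ (Complex.log κ.1, κ.2) (F.slice y) := by
      rw [expAct, Complex.exp_log hκ]
    rw [h4, expAct_inl, slice_inl, slice_inl] at h3
    have h5 : Complex.exp (F.L (Complex.log κ.1, κ.2) j) = 1 :=
      mul_right_cancel₀ (F.ne_zero j) (by rw [← h3, one_mul])
    rw [Pi.zero_apply, ← Complex.log_exp (hκD.2 j).1 (hκD.2 j).2.le, h5, Complex.log_one]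
  have hκ1 : (Complex.log κ.1, κ.2) = 0 := by simpa using hL
  ext k
  have h3 := congrFun hyy' (F.σ (Sum.inr k))
  have h4 : leafAct Λ κ (F.slice y) = expAct Λ (Complex.log κ.1, κ.2) (F.slice y) := by
    rw [expAct, Complex.exp_log hκ]
  rw [h4, hκ1, expAct_apply] at h3
  simpa using h3

end Frame

/-! ### The quotient complex structure -/

/-- A local homeomorphism from the leaf space to its model is a leaf chart if its inverse lifts to
a holomorphic map to the cone and if its composition with the projection is holomorphic. -/
structure IsLeafChart {m n : ℕ} (Λ : Fin n → Fin m → ℂ)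
    (e : OpenPartialHomeomorph (N Λ) (Model n m)) : Prop where
  exists_lift : ∃ s : Model n m → cone Λ,
    ContMDiffOn 𝓘(ℂ, Model n m) 𝓘(ℂ, Fin n → ℂ) ω s e.target ∧
    ∀ y ∈ e.target, proj Λ (s y) = e.symm y
  contMDiffOn_comp_proj :
    ContMDiffOn 𝓘(ℂ, Fin n → ℂ) 𝓘(ℂ, Model n m) ω (e ∘ proj Λ) (proj Λ ⁻¹' e.source)

/-- A map into an open submanifold is holomorphic if its composition with the inclusion is. -/
theorem contMDiffWithinAt_opens_of_val {E H M E' H' M' : Type*} [NormedAddCommGroup E]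
    [NormedSpace ℂ E] [TopologicalSpace H] {I : ModelWithCorners ℂ E H} [TopologicalSpace M]
    [ChartedSpace H M] [NormedAddCommGroup E'] [NormedSpace ℂ E'] [TopologicalSpace H']
    {I' : ModelWithCorners ℂ E' H'} [TopologicalSpace M'] [ChartedSpace H' M']
    {U : TopologicalSpace.Opens M'} {f : M → U} {s : Set M} {x : M}
    (h : ContMDiffWithinAt I I' ω (Subtype.val ∘ f) s x) : ContMDiffWithinAt I I' ω f s x :=
  (ChartedSpace.liftPropWithinAt_subtypeVal_comp_iff ..).1 h

section Charts

variable {m n : ℕ} {Λ : Fin n → Fin m → ℂ} {z₀ : Fin n → ℂ}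

theorem proj_expAct {κ : ℂ × (Fin m → ℂ)} {z w : cone Λ}
    (h : (w : Fin n → ℂ) = expAct Λ κ z) : proj Λ z = proj Λ w :=
  proj_eq_iff.2 ⟨(Complex.exp κ.1, κ.2), Complex.exp_ne_zero _, h⟩

theorem contDiff_leafAct (κ : ℂ × (Fin m → ℂ)) : ContDiff ℂ ω (leafAct Λ κ) := by
  refine contDiff_pi.2 fun i => ?_
  unfold leafAct
  fun_prop

/-- The leaf chart defined by a slice: the points of the slice close to `z₀` parametrize an open
set of the leaf space, and the chart is the first component of `straighten`. -/
theorem Frame.exists_leafChart (F : Frame Λ z₀) (hm : 0 < m) (hΛ : Admissible Λ)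
    (hz₀ : z₀ ∈ cone Λ) :
    ∃ e : OpenPartialHomeomorph (N Λ) (Model n m), IsLeafChart Λ e ∧
      proj Λ ⟨z₀, hz₀⟩ ∈ e.source ∧
      (∀ y ∈ e.target, ∃ h : F.slice y ∈ cone Λ, proj Λ ⟨F.slice y, h⟩ = e.symm y) ∧
      F.rest z₀ ∈ e.target ∧
      ∀ z : cone Λ, (z : Fin n → ℂ) ∈ F.straighten.source → (F.straighten z).1 ∈ e.target →
        proj Λ z ∈ e.source ∧ e (proj Λ z) = (F.straighten z).1 := by
  classical
  obtain ⟨O, hO, hz₀O, hOcone, hOinj⟩ := F.exists_isOpen_slice_injOn hm hΛ hz₀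
  set s : Model n m → cone Λ := fun y =>
    if h : F.slice y ∈ cone Λ then ⟨F.slice y, h⟩ else ⟨z₀, hz₀⟩ with hs
  have hsO : ∀ y (hy : F.slice y ∈ cone Λ), s y = ⟨F.slice y, hy⟩ := fun y hy => by
    rw [hs]
    exact dif_pos hy
  have hssm : ContMDiffOn 𝓘(ℂ, Model n m) 𝓘(ℂ, Fin n → ℂ) ω s O := fun y hy =>
    contMDiffWithinAt_opens_of_val <|
      F.contDiff_slice.contMDiff.contMDiffAt.contMDiffWithinAt.congr
        (fun y hy => by rw [Function.comp_apply, hsO y (hOcone y hy)])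
        (by rw [Function.comp_apply, hsO y (hOcone y hy)])
  set g : Model n m → N Λ := fun y => proj Λ (s y) with hg
  have hgO : ∀ y (hy : F.slice y ∈ cone Λ), g y = proj Λ ⟨F.slice y, hy⟩ := fun y hy => by
    rw [hg, ← hsO y hy]
  have hinj : InjOn g O := by
    intro y hy y' hy' h
    rw [hgO y (hOcone y hy), hgO y' (hOcone y' hy')] at h
    obtain ⟨κ, hκ, h⟩ := proj_eq_iff.1 h
    exact (hOinj y hy y' hy' κ hκ h).symm
  have hcont : ContinuousOn g O := continuous_proj.comp_continuousOn hssm.continuousOn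
  -- a point of the cone with straightened coordinates over `O` projects to a point of `g '' O`
  have hstr : ∀ z : cone Λ, (z : Fin n → ℂ) ∈ F.straighten.source → (F.straighten z).1 ∈ O →
      proj Λ z = g (F.straighten z).1 := by
    intro z hz hzO
    rw [hgO _ (hOcone _ hzO)]
    exact (proj_expAct (F.eq_expAct_slice hz)).symm
  have hopen : ∀ V : Set (Model n m), V ⊆ O → IsOpen V → IsOpen (g '' V) := by
    intro V hVO hV
    have heq : g '' V = proj Λ '' {z : cone Λ | (z : Fin n → ℂ) ∈ F.straighten.source ∩
        F.straighten ⁻¹' (Prod.fst ⁻¹' V)} := by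
      ext p
      constructor
      · rintro ⟨y, hy, rfl⟩
        refine ⟨⟨F.slice y, hOcone y (hVO hy)⟩, ⟨F.slice_mem_straighten_source y, ?_⟩,
          (hgO y _).symm⟩
        change (F.straighten (F.slice y)).1 ∈ V
        rwa [F.straighten_slice]
      · rintro ⟨z, ⟨hz, hzV⟩, rfl⟩
        exact ⟨_, hzV, (hstr z hz (hVO hzV)).symm⟩
    rw [heq]
    exact isOpenMap_proj _ ((F.straighten.isOpen_inter_preimage
      (hV.preimage continuous_fst)).preimage continuous_subtype_val)
  have hopenMap : IsOpenMap (hinj.toPartialEquiv.source.domRestrict hinj.toPartialEquiv) := by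
    intro V hV
    have : O.domRestrict g '' V = g '' (Subtype.val '' V) := by
      rw [← image_comp]
      rfl
    change IsOpen (O.domRestrict g '' V)
    rw [this]
    exact hopen _ (Subtype.coe_image_subset O V) (hO.isOpenMap_subtype_val V hV)
  obtain ⟨e, heT, hesymm⟩ : ∃ e : OpenPartialHomeomorph (N Λ) (Model n m),
      e.target = O ∧ ∀ y, e.symm y = g y :=
    ⟨(OpenPartialHomeomorph.ofContinuousOpenRestrict hinj.toPartialEquiv hcont hopenMap hO).symm,
      rfl, fun _ => rfl⟩
  subst heT
  have hes : ∀ y ∈ e.target, proj Λ (s y) = e.symm y := fun y _ => (hesymm y).symm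
  clear_value g s
  have hlift : ∀ y ∈ e.target, ∃ h : F.slice y ∈ cone Λ, proj Λ ⟨F.slice y, h⟩ = e.symm y :=
    fun y hy => ⟨hOcone y hy, by rw [hesymm, hgO]⟩
  have hestr : ∀ z : cone Λ, (z : Fin n → ℂ) ∈ F.straighten.source →
      (F.straighten z).1 ∈ e.target →
      proj Λ z ∈ e.source ∧ e (proj Λ z) = (F.straighten z).1 := by
    intro z hz hzO
    rw [hstr z hz hzO, ← hesymm]
    exact ⟨e.map_target hzO, e.right_inv hzO⟩
  refine ⟨e, ⟨⟨s, hssm, hes⟩, ?_⟩, ?_, hlift, hz₀O, hestr⟩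
  · -- move a point of the cone to the slice by the action, and apply `straighten`
    intro z hz
    obtain ⟨hy, hy'⟩ := hlift (e (proj Λ z)) (e.map_source hz)
    rw [e.left_inv hz] at hy'
    obtain ⟨κ, hκ, hslice⟩ := proj_eq_iff.1 hy'.symm
    have hκz : leafAct Λ κ z ∈ F.straighten.source := by
      rw [← hslice]
      exact F.slice_mem_straighten_source _
    have hsm : ContDiffAt ℂ ω (fun w => (F.straighten (leafAct Λ κ w)).1) (z : Fin n → ℂ) :=
      contDiffAt_fst.comp _ (((F.contDiffOn_straighten _ hκz).contDiffAt
        (F.straighten.open_source.mem_nhds hκz)).comp _ (contDiff_leafAct κ).contDiffAt)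
    have hsm' : ContMDiffAt 𝓘(ℂ, Fin n → ℂ) 𝓘(ℂ, Model n m) ω
        (fun w : cone Λ => (F.straighten (leafAct Λ κ w)).1) z :=
      contMDiffAt_subtype_iff.2 hsm.contMDiffAt
    have hev : ∀ᶠ w : cone Λ in 𝓝 z, leafAct Λ κ w ∈
        F.straighten.source ∩ F.straighten ⁻¹' (Prod.fst ⁻¹' e.target) := by
      refine ((contDiff_leafAct κ).continuous.comp continuous_subtype_val).continuousAt.eventually
        ((F.straighten.isOpen_inter_preimage (e.open_target.preimage continuous_fst)).mem_nhds ?_)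
      refine ⟨hκz, ?_⟩
      change (F.straighten (leafAct Λ κ z)).1 ∈ e.target
      rw [← hslice, F.straighten_slice]
      exact e.map_source hz
    refine (hsm'.congr_of_eventuallyEq ?_).contMDiffWithinAt
    filter_upwards [hev] with w hw
    have hwp : proj Λ w = proj Λ ⟨leafAct Λ κ w, (leafAct_mem_cone hκ).2 w.2⟩ :=
      proj_eq_iff.2 ⟨κ, hκ, rfl⟩
    have hw' := (hestr ⟨leafAct Λ κ w, (leafAct_mem_cone hκ).2 w.2⟩ hw.1 hw.2).2
    rw [Function.comp_apply, hwp, hw']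
  · have := (hestr ⟨z₀, hz₀⟩ ?_ ?_).1
    · exact this
    · have := F.slice_mem_straighten_source (F.rest z₀)
      rwa [F.slice_rest] at this
    · have := F.straighten_slice (F.rest z₀)
      rw [F.slice_rest] at this
      rw [this]
      exact hz₀O

theorem exists_leafChart (hm : 0 < m) (hΛ : Admissible Λ) (p : N Λ) :
    ∃ e : OpenPartialHomeomorph (N Λ) (Model n m), IsLeafChart Λ e ∧ p ∈ e.source := by
  obtain ⟨z, rfl⟩ := proj_surjective p
  obtain ⟨F⟩ := nonempty_frame hΛ z.2
  obtain ⟨e, he, hz, -⟩ := F.exists_leafChart hm hΛ z.2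
  exact ⟨e, he, hz⟩

/-- The charted space structure on the leaf space whose atlas consists of all leaf charts. -/
@[reducible]
noncomputable def leafChartedSpace (hm : 0 < m) (hΛ : Admissible Λ) :
    ChartedSpace (Model n m) (N Λ) where
  atlas := {e | IsLeafChart Λ e}
  chartAt p := (exists_leafChart hm hΛ p).choose
  mem_chart_source p := (exists_leafChart hm hΛ p).choose_spec.2
  chart_mem_atlas p := (exists_leafChart hm hΛ p).choose_spec.1

theorem IsLeafChart.contDiffOn_comp_symm {e e' : OpenPartialHomeomorph (N Λ) (Model n m)}
    (he : IsLeafChart Λ e) (he' : IsLeafChart Λ e') :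
    ContDiffOn ℂ ω (e' ∘ e.symm) (e.target ∩ e.symm ⁻¹' e'.source) := by
  obtain ⟨s, hs, hps⟩ := he.exists_lift
  rw [← contMDiffOn_iff_contDiffOn]
  have hmaps : MapsTo s (e.target ∩ e.symm ⁻¹' e'.source) (proj Λ ⁻¹' e'.source) := by
    intro y hy
    rw [mem_preimage, hps y hy.1]
    exact hy.2
  refine (he'.contMDiffOn_comp_proj.comp (hs.mono inter_subset_left) hmaps).congr fun y hy => ?_
  simp [hps y hy.1]

theorem isManifold_leafChartedSpace (hm : 0 < m) (hΛ : Admissible Λ) :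
    letI := leafChartedSpace hm hΛ
    IsManifold 𝓘(ℂ, Model n m) ω (N Λ) := by
  let := leafChartedSpace hm hΛ
  refine isManifold_of_contDiffOn _ _ _ fun e e' he he' => ?_
  have := IsLeafChart.contDiffOn_comp_symm he he'
  simpa using this

/-- The projection is the first component of `straighten`, read in a leaf chart. -/
theorem isSubmersion_proj (hm : 0 < m) (hΛ : Admissible Λ) :
    letI := leafChartedSpace hm hΛ
    Manifold.IsSubmersion 𝓘(ℂ, Fin n → ℂ) 𝓘(ℂ, Model n m) ω (proj Λ) := by
  let := leafChartedSpace hm hΛ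
  have := isManifold_leafChartedSpace hm hΛ
  refine ⟨Fin (m + 1) → ℂ, inferInstance, inferInstance, fun z₀ => ?_⟩
  obtain ⟨F⟩ := nonempty_frame hΛ z₀.2
  obtain ⟨e, he, hz₀, -, hz₀T, hestr⟩ := F.exists_leafChart hm hΛ z₀.2
  let Q : (Fin n → ℂ) ≃L[ℂ] Model n m × (Fin (m + 1) → ℂ) := LinearEquiv.toContinuousLinearEquiv
    { toFun := fun x => (fun k => x (F.σ (Sum.inr k)), fun j => x (F.σ (Sum.inl j)))
      map_add' := fun x y => rfl
      map_smul' := fun c x => rfl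
      invFun := fun y i => Sum.elim y.2 y.1 (F.σ.symm i)
      left_inv := fun x => by
        ext i
        obtain ⟨i, rfl⟩ := F.σ.surjective i
        rcases i with j | k <;> simp
      right_inv := fun y => by simp }
  let ψ : OpenPartialHomeomorph (Fin n → ℂ) (Fin n → ℂ) :=
    (F.straighten.trans Q.symm.toHomeomorph.toOpenPartialHomeomorph).restr
      (F.straighten.source ∩ F.straighten ⁻¹' (Prod.fst ⁻¹' e.target))
  have hψV : IsOpen (F.straighten.source ∩ F.straighten ⁻¹' (Prod.fst ⁻¹' e.target)) :=
    F.straighten.isOpen_inter_preimage (e.open_target.preimage continuous_fst)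
  have hψs : ψ.source = F.straighten.source ∩ F.straighten ⁻¹' (Prod.fst ⁻¹' e.target) := by
    simp only [ψ, OpenPartialHomeomorph.restr_source, hψV.interior_eq]
    ext z
    simp
  have hψ : ∀ z, ψ z = Q.symm (F.straighten z) := fun z => rfl
  have hψsymm : ∀ x, ψ.symm x = F.straighten.symm (Q x) := fun x => rfl
  let φ : OpenPartialHomeomorph (cone Λ) (Fin n → ℂ) := ψ.subtypeRestr ⟨z₀⟩
  have hφs : φ.source = Subtype.val ⁻¹' ψ.source := OpenPartialHomeomorph.subtypeRestr_source ..
  have hφ : ∀ z, φ z = ψ z := fun z => rfl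
  have hφsymm : ∀ x ∈ φ.target, (φ.symm x : Fin n → ℂ) = F.straighten.symm (Q x) := fun x hx =>
    (OpenPartialHomeomorph.subtypeRestr_symm_apply _ ⟨z₀⟩ hx).trans (hψsymm x)
  have hφatlas : φ ∈ IsManifold.maximalAtlas 𝓘(ℂ, Fin n → ℂ) ω (cone Λ) := by
    refine φ.mem_maximalAtlas_of_contMDiffOn ?_ ?_
    · intro z hz
      have hz' : (z : Fin n → ℂ) ∈ F.straighten.source := by
        rw [hφs, hψs] at hz
        exact hz.1
      have hsm : ContDiffAt ℂ ω (fun w => Q.symm (F.straighten w)) (z : Fin n → ℂ) :=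
        Q.symm.contDiff.contDiffAt.comp _ ((F.contDiffOn_straighten _ hz').contDiffAt
          (F.straighten.open_source.mem_nhds hz'))
      have hsm' : ContMDiffAt 𝓘(ℂ, Fin n → ℂ) 𝓘(ℂ, Fin n → ℂ) ω
          (fun w : cone Λ => Q.symm (F.straighten w)) z :=
        contMDiffAt_subtype_iff.2 hsm.contMDiffAt
      exact hsm'.contMDiffWithinAt
    · intro x hx
      refine contMDiffWithinAt_opens_of_val ?_
      have hsymm := (F.contDiff_straighten_symm.comp Q.contDiff).contMDiff
      exact hsymm.contMDiffAt.contMDiffWithinAt.congr (fun x hx => hφsymm x hx) (hφsymm x hx)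
  have heatlas : e ∈ IsManifold.maximalAtlas 𝓘(ℂ, Model n m) ω (N Λ) :=
    IsManifold.subset_maximalAtlas he
  have hsrc : ∀ z ∈ φ.source, proj Λ z ∈ e.source ∧ e (proj Λ z) = (F.straighten z).1 := by
    intro z hz
    rw [hφs, hψs] at hz
    exact hestr z hz.1 hz.2
  refine Manifold.IsSubmersionAtOfComplement.mk_of_charts Q φ e ?_ hz₀ hφatlas heatlas
    (fun z hz => (hsrc z hz).1) ?_
  · rw [hφs, hψs, mem_preimage]
    have h1 := F.slice_mem_straighten_source (F.rest z₀)
    have h2 := F.straighten_slice (F.rest z₀)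
    rw [F.slice_rest] at h1 h2
    refine ⟨h1, ?_⟩
    rw [mem_preimage, mem_preimage, h2]
    exact hz₀T
  · intro x hx
    have hx' : x ∈ φ.target := by simpa using hx
    have hz := φ.map_target hx'
    have h1 := (hsrc _ hz).2
    have h2 : F.straighten (φ.symm x) = Q x := by
      have h3 := φ.right_inv hx'
      rw [hφ, hψ] at h3
      rw [← Q.apply_symm_apply (F.straighten (φ.symm x)), h3]
    rw [h2] at h1
    simpa using h1

theorem isQuotientComplexStructure_leafChartedSpace (hm : 0 < m) (hΛ : Admissible Λ) :
    letI := leafChartedSpace hm hΛ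
    IsQuotientComplexStructure Λ :=
  letI := leafChartedSpace hm hΛ
  ⟨isManifold_leafChartedSpace hm hΛ, isSubmersion_proj hm hΛ⟩

end Charts

/-! ### Maps between leaf spaces with arbitrary quotient complex structures -/

/-- A submersion has local holomorphic sections. -/
theorem exists_contMDiffOn_section {E E' F M M' : Type*} [NormedAddCommGroup E]
    [NormedSpace ℂ E] [NormedAddCommGroup E'] [NormedSpace ℂ E'] [NormedAddCommGroup F]
    [NormedSpace ℂ F] [TopologicalSpace M] [ChartedSpace E M] [IsManifold 𝓘(ℂ, E) ω M]
    [TopologicalSpace M'] [ChartedSpace E' M'] [IsManifold 𝓘(ℂ, E') ω M'] {f : M → M'} {x : M}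
    (hf : Manifold.IsSubmersionAtOfComplement F 𝓘(ℂ, E) 𝓘(ℂ, E') ω f x) :
    ∃ (V : Set M') (s : M' → M), IsOpen V ∧ f x ∈ V ∧
      ContMDiffOn 𝓘(ℂ, E') 𝓘(ℂ, E) ω s V ∧ ∀ y ∈ V, f (s y) = y := by
  set φ := hf.domChart
  set χ := hf.codChart
  set Q := hf.equiv
  have hχ : ∀ u ∈ φ.target, χ (f (φ.symm u)) = (Q u).1 := fun u hu => by
    simpa using hf.writtenInCharts (show u ∈ (φ.extend 𝓘(ℂ, E)).target by simpa using hu)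
  have hmaps := hf.mapsto_domChart_source_codChart_source
  set v := (Q (φ x)).2
  -- freeze the second component in the normal form `(u, v) ↦ u`
  set j : E' → E := fun u => Q.symm (u, v) with hj
  have hjsm : ContDiff ℂ ω j := Q.symm.contDiff.comp (contDiff_id.prodMk contDiff_const)
  have hx := hf.mem_domChart_source
  have hjx : j (χ (f x)) = φ x := by
    have h1 := hχ _ (φ.map_source hx)
    rw [φ.left_inv hx] at h1
    rw [h1]
    exact Q.symm_apply_apply (φ x)
  refine ⟨χ.source ∩ χ ⁻¹' (j ⁻¹' φ.target), fun y => φ.symm (j (χ y)),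
    χ.isOpen_inter_preimage (φ.open_target.preimage hjsm.continuous),
    ⟨hf.mem_codChart_source, ?_⟩, ?_, ?_⟩
  · rw [mem_preimage, mem_preimage, hjx]
    exact φ.map_source hx
  · have h1 := contMDiffOn_of_mem_maximalAtlas hf.codChart_mem_maximalAtlas
    have h2 := contMDiffOn_symm_of_mem_maximalAtlas hf.domChart_mem_maximalAtlas
    exact h2.comp (hjsm.contMDiff.comp_contMDiffOn (h1.mono inter_subset_left))
      fun y hy => hy.2
  · rintro y ⟨hy, hy'⟩
    refine χ.injOn (hmaps (φ.map_target hy')) hy ?_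
    rw [hχ _ hy', hj]
    simp

section Quotient

variable {m n : ℕ} {Λ : Fin n → Fin m → ℂ} [ChartedSpace (Model n m) (N Λ)]

/-- A map on an open subset of the leaf space is holomorphic if its composition with the
projection is. -/
theorem IsQuotientComplexStructure.contMDiffOn_of_comp_proj (hQ : IsQuotientComplexStructure Λ)
    {E M : Type*} [NormedAddCommGroup E] [NormedSpace ℂ E] [TopologicalSpace M]
    [ChartedSpace E M] {f : N Λ → M} {V : Set (N Λ)} (hV : IsOpen V)
    (hf : ContMDiffOn 𝓘(ℂ, Fin n → ℂ) 𝓘(ℂ, E) ω (f ∘ proj Λ) (proj Λ ⁻¹' V)) :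
    ContMDiffOn 𝓘(ℂ, Model n m) 𝓘(ℂ, E) ω f V := by
  have := hQ.isManifold
  intro p hp
  obtain ⟨z, rfl⟩ := proj_surjective p
  obtain ⟨F, _, _, hF⟩ := hQ.submersion
  obtain ⟨V', s, hV', hzV', hs, hsproj⟩ := exists_contMDiffOn_section (hF z)
  have hcomp : ContMDiffOn 𝓘(ℂ, Model n m) 𝓘(ℂ, E) ω ((f ∘ proj Λ) ∘ s) (V ∩ V') := by
    refine hf.comp (hs.mono inter_subset_right) fun y hy => ?_
    change proj Λ (s y) ∈ V
    rw [hsproj y hy.2]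
    exact hy.1
  refine ContMDiffAt.contMDiffWithinAt ?_
  refine ((hcomp.congr fun y hy => ?_).contMDiffAt
    ((hV.inter hV').mem_nhds ⟨hp, hzV'⟩))
  simp [hsproj y hy.2]

/-- Leaf charts are holomorphic charts of every quotient complex structure. -/
theorem IsLeafChart.mem_maximalAtlas (hQ : IsQuotientComplexStructure Λ)
    {e : OpenPartialHomeomorph (N Λ) (Model n m)} (he : IsLeafChart Λ e) :
    e ∈ IsManifold.maximalAtlas 𝓘(ℂ, Model n m) ω (N Λ) := by
  have := hQ.isManifold
  refine e.mem_maximalAtlas_of_contMDiffOn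
    (hQ.contMDiffOn_of_comp_proj e.open_source he.contMDiffOn_comp_proj) ?_
  obtain ⟨s, hs, hps⟩ := he.exists_lift
  exact (hQ.submersion.contMDiff.comp_contMDiffOn hs).congr fun y hy => (hps y hy).symm

end Quotient

section CoordLocus

variable {m n : ℕ} {Λ : Fin n → Fin m → ℂ}

theorem proj_mem_coordLocus_iff {I : Set (Fin n)} {z : cone Λ} :
    proj Λ z ∈ coordLocus Λ I ↔ ∀ i ∈ I, (z : Fin n → ℂ) i = 0 := by
  constructor
  · rintro ⟨w, hw, h⟩ i hi
    obtain ⟨κ, -, h⟩ := proj_eq_iff.1 h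
    rw [h, leafAct, hw i hi, mul_zero, mul_zero]
  · exact fun h => ⟨z, h, rfl⟩

theorem isClosed_coordLocus (I : Set (Fin n)) : IsClosed (coordLocus Λ I) := by
  rw [← isOpenQuotientMap_proj.isQuotientMap.isClosed_preimage]
  have : proj Λ ⁻¹' coordLocus Λ I = ⋂ i ∈ I, {z : cone Λ | (z : Fin n → ℂ) i = 0} := by
    ext z
    simp [proj_mem_coordLocus_iff]
  rw [this]
  exact isClosed_biInter fun i _ =>
    isClosed_eq ((continuous_apply i).comp continuous_subtype_val) continuous_const

theorem dense_compl_coordLocus {I : Set (Fin n)} (hI : I.Nonempty) :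
    Dense (coordLocus Λ I)ᶜ := by
  obtain ⟨i, hi⟩ := hI
  have h1 : Dense {z : Fin n → ℂ | z i ≠ 0} :=
    (dense_compl_singleton (0 : ℂ)).preimage (isOpenMap_eval i)
  have h2 : Dense {z : cone Λ | (z : Fin n → ℂ) i ≠ 0} :=
    h1.preimage (cone Λ).2.isOpenMap_subtype_val
  refine (proj_surjective.denseRange.dense_image continuous_proj h2).mono ?_
  rintro _ ⟨z, hz, rfl⟩ hmem
  exact hz (proj_mem_coordLocus_iff.1 hmem i hi)

/-- In the leaf chart of a slice through a point of `V ∩ {z i = 0 | i ∈ I}`, the image of this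
set is a coordinate subspace, since the coordinates of the first group do not vanish. -/
theorem isComplexSubmanifold_coordLocus [ChartedSpace (Model n m) (N Λ)] (hm : 0 < m)
    (hΛ : Admissible Λ) (hQ : IsQuotientComplexStructure Λ) (I : Set (Fin n)) :
    IsComplexSubmanifold (Model n m) (coordLocus Λ I) I.ncard := by
  classical
  rintro _ ⟨z₀, hz₀, rfl⟩
  obtain ⟨F⟩ := nonempty_frame hΛ z₀.2
  obtain ⟨e, he, hez₀, hlift, -⟩ := F.exists_leafChart hm hΛ z₀.2
  refine ⟨e, he.mem_maximalAtlas hQ, hez₀, ?_⟩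
  let K : Set (Fin (n - m - 1)) := {k | F.σ (Sum.inr k) ∈ I}
  have hI : ∀ j, F.σ (Sum.inl j) ∉ I := fun j hj => F.ne_zero j (hz₀ _ hj)
  have hcard : I.ncard = Fintype.card K := by
    have hIK : I = (fun k => F.σ (Sum.inr k)) '' K := by
      ext i
      obtain ⟨i, rfl⟩ := F.σ.surjective i
      rcases i with j | k
      · simp [hI]
      · simp [K]
    calc I.ncard = ((fun k => F.σ (Sum.inr k)) '' K).ncard := congrArg _ hIK
      _ = K.ncard :=
        Set.ncard_image_of_injective _ (F.σ.injective.comp Sum.inr_injective)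
      _ = Fintype.card K := Nat.card_eq_fintype_card
  refine ⟨LinearMap.ker (LinearMap.funLeft ℂ ℂ (Subtype.val : K → Fin (n - m - 1))), ?_, ?_⟩
  · have h1 := LinearMap.finrank_range_add_finrank_ker
      (LinearMap.funLeft ℂ ℂ (Subtype.val : K → Fin (n - m - 1)))
    rw [LinearMap.range_eq_top.2 (LinearMap.funLeft_surjective_of_injective ℂ ℂ _
      Subtype.val_injective), finrank_top, Module.finrank_fintype_fun_eq_card] at h1
    rw [hcard, ← h1, add_comm]
  · intro q hq
    obtain ⟨h, hq'⟩ := hlift _ (e.map_source hq)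
    rw [e.left_inv hq] at hq'
    rw [← hq', proj_mem_coordLocus_iff, hq', LinearMap.mem_ker, funext_iff]
    constructor
    · rintro h0 ⟨k, hk⟩
      have hk0 : F.slice (e q) (F.σ (Sum.inr k)) = 0 := h0 _ hk
      rwa [F.slice_inr] at hk0
    · intro h0 i hi
      obtain ⟨i, rfl⟩ := F.σ.surjective i
      rcases i with j | k
      · exact (hI j hi).elim
      · change F.slice (e q) _ = 0
        rw [F.slice_inr]
        exact h0 ⟨k, hi⟩

end CoordLocus

section Transfer

variable {m n : ℕ} {Λ Λ' : Fin n → Fin m → ℂ}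

/-- The map between leaf spaces induced by the identity on the points with homogeneous coordinates
in both cones; the value at the other points is immaterial. -/
noncomputable def transfer (Λ Λ' : Fin n → Fin m → ℂ) [Nonempty (N Λ')] (p : N Λ) : N Λ' :=
  open Classical in
  if h : ∃ (z : cone Λ) (z' : cone Λ'), (z : Fin n → ℂ) = z' ∧ proj Λ z = p then
    proj Λ' h.choose_spec.choose
  else Classical.arbitrary _

/-- Translating the configuration changes the action only by scalars, so that the equivalence
relation on homogeneous coordinates does not change. -/
theorem transfer_proj [Nonempty (N Λ')] {u : Fin m → ℂ} (hu : Λ' = translate Λ u) {z : cone Λ}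
    {z' : cone Λ'} (h : (z : Fin n → ℂ) = z') : transfer Λ Λ' (proj Λ z) = proj Λ' z' := by
  have hex : ∃ (w : cone Λ) (w' : cone Λ'), (w : Fin n → ℂ) = w' ∧ proj Λ w = proj Λ z :=
    ⟨z, z', h, rfl⟩
  rw [transfer, dif_pos hex]
  have h12 := hex.choose_spec.choose_spec
  generalize hex.choose_spec.choose = w' at h12 ⊢
  obtain ⟨h1, h2⟩ := h12
  obtain ⟨κ, hκ, h3⟩ := proj_eq_iff.1 h2
  refine proj_eq_iff.2 ⟨(κ.1 * Complex.exp (-(u ⬝ᵥ κ.2)), κ.2),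
    mul_ne_zero hκ (Complex.exp_ne_zero _), ?_⟩
  rw [← h, h3, h1]
  ext i
  have : Complex.exp (-(u ⬝ᵥ κ.2)) * Complex.exp (Λ' i ⬝ᵥ κ.2) = Complex.exp (Λ i ⬝ᵥ κ.2) := by
    rw [← Complex.exp_add, hu, translate, add_dotProduct]
    congr 1
    ring
  simp only [leafAct]
  rw [← this]
  ring

theorem contMDiffOn_transfer [ChartedSpace (Model n m) (N Λ)] [ChartedSpace (Model n m) (N Λ')]
    [Nonempty (N Λ')] (hQ : IsQuotientComplexStructure Λ) (hQ' : IsQuotientComplexStructure Λ')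
    {u : Fin m → ℂ} (hu : Λ' = translate Λ u) {V : Set (N Λ)} (hV : IsOpen V)
    (hVcone : ∀ z : cone Λ, proj Λ z ∈ V → (z : Fin n → ℂ) ∈ cone Λ') :
    ContMDiffOn 𝓘(ℂ, Model n m) 𝓘(ℂ, Model n m) ω (transfer Λ Λ') V := by
  refine hQ.contMDiffOn_of_comp_proj hV fun z hz => ?_
  have hz' := hVcone z hz
  classical
  set j : cone Λ → cone Λ' := fun w =>
    if h : (w : Fin n → ℂ) ∈ cone Λ' then ⟨w, h⟩ else ⟨z, hz'⟩ with hj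
  have hval : ∀ w ∈ proj Λ ⁻¹' V, (j w : Fin n → ℂ) = w := fun w hw => by
    rw [hj]
    simp only [dif_pos (hVcone w hw)]
  have hjsm : ContMDiffWithinAt 𝓘(ℂ, Fin n → ℂ) 𝓘(ℂ, Fin n → ℂ) ω j (proj Λ ⁻¹' V) z :=
    contMDiffWithinAt_opens_of_val <|
      (contMDiff_subtype_val (n := ω)).contMDiffAt.contMDiffWithinAt.congr hval (hval z hz)
  refine (hQ'.submersion.contMDiff.contMDiffAt.comp_contMDiffWithinAt z hjsm).congr
    (fun w hw => ?_) ?_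
  · exact transfer_proj hu (hval w hw).symm
  · exact transfer_proj hu (hval z hz).symm

/-- If the points of each cone outside of a coordinate locus belong to the other cone, outside of
the other coordinate locus, the identity induces a biholomorphism between the complements of the
loci in the leaf spaces. -/
theorem exists_biholomorphism [ChartedSpace (Model n m) (N Λ)]
    [ChartedSpace (Model n m) (N Λ')] [Nonempty (N Λ)] [Nonempty (N Λ')]
    (hQ : IsQuotientComplexStructure Λ) (hQ' : IsQuotientComplexStructure Λ')
    {u : Fin m → ℂ} (hu : Λ' = translate Λ u) {I I' : Set (Fin n)}
    (h : ∀ z ∈ cone Λ, (∃ i ∈ I, z i ≠ 0) → z ∈ cone Λ' ∧ ∃ i ∈ I', z i ≠ 0)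
    (h' : ∀ z ∈ cone Λ', (∃ i ∈ I', z i ≠ 0) → z ∈ cone Λ ∧ ∃ i ∈ I, z i ≠ 0) :
    ∃ f : OpenPartialHomeomorph (N Λ) (N Λ'), f.source = (coordLocus Λ I)ᶜ ∧
      f.target = (coordLocus Λ' I')ᶜ ∧ IsBiholomorphic (Model n m) f ∧
      ∀ (z : cone Λ) (z' : cone Λ'), (z : Fin n → ℂ) = z' → f (proj Λ z) = proj Λ' z' := by
  have hu' : Λ = translate Λ' (-u) := by
    rw [hu]
    ext i k
    simp [translate]
  have hmem : ∀ {Λ₁ : Fin n → Fin m → ℂ} {J : Set (Fin n)} {z : cone Λ₁},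
      proj Λ₁ z ∈ (coordLocus Λ₁ J)ᶜ ↔ ∃ i ∈ J, (z : Fin n → ℂ) i ≠ 0 := by
    intro Λ₁ J z
    rw [mem_compl_iff, proj_mem_coordLocus_iff]
    push Not
    rfl
  have hsm := contMDiffOn_transfer hQ hQ' hu (isClosed_coordLocus I).isOpen_compl
    fun z hz => (h z z.2 (hmem.1 hz)).1
  have hsm' := contMDiffOn_transfer hQ' hQ hu' (isClosed_coordLocus I').isOpen_compl
    fun z hz => (h' z z.2 (hmem.1 hz)).1
  let f : OpenPartialHomeomorph (N Λ) (N Λ') :=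
    { toFun := transfer Λ Λ'
      invFun := transfer Λ' Λ
      source := (coordLocus Λ I)ᶜ
      target := (coordLocus Λ' I')ᶜ
      map_source' := fun p hp => by
        obtain ⟨z, rfl⟩ := proj_surjective p
        obtain ⟨h1, h2⟩ := h z z.2 (hmem.1 hp)
        rw [transfer_proj (z' := ⟨z, h1⟩) hu rfl]
        exact hmem.2 h2
      map_target' := fun p hp => by
        obtain ⟨z, rfl⟩ := proj_surjective p
        obtain ⟨h1, h2⟩ := h' z z.2 (hmem.1 hp)
        rw [transfer_proj (z' := ⟨z, h1⟩) hu' rfl]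
        exact hmem.2 h2
      left_inv' := fun p hp => by
        obtain ⟨z, rfl⟩ := proj_surjective p
        obtain ⟨h1, h2⟩ := h z z.2 (hmem.1 hp)
        rw [transfer_proj (z' := ⟨z, h1⟩) hu rfl, transfer_proj (z' := z) hu' rfl]
      right_inv' := fun p hp => by
        obtain ⟨z, rfl⟩ := proj_surjective p
        obtain ⟨h1, h2⟩ := h' z z.2 (hmem.1 hp)
        rw [transfer_proj (z' := ⟨z, h1⟩) hu' rfl, transfer_proj (z' := z) hu rfl]
      continuousOn_toFun := hsm.continuousOn
      continuousOn_invFun := hsm'.continuousOn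
      open_source := (isClosed_coordLocus I).isOpen_compl
      open_target := (isClosed_coordLocus I').isOpen_compl }
  exact ⟨f, rfl, rfl, ⟨hsm, hsm'⟩, fun z z' hz => transfer_proj hu hz⟩

end Transfer

/-! ### Compactifications -/

/-- A biholomorphism from an open subset onto a dense open subset of a compact Hausdorff complex
manifold is a compactification. -/
theorem isHolomorphicCompactification_of_isBiholomorphic {E M M' : Type*} [NormedAddCommGroup E]
    [NormedSpace ℂ E] [TopologicalSpace M] [ChartedSpace E M]
    [TopologicalSpace M'] [ChartedSpace E M'] [CompactSpace M'] [T2Space M']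
    [IsManifold 𝓘(ℂ, E) ω M'] {f : OpenPartialHomeomorph M M'} (hf : IsBiholomorphic E f)
    (hdense : Dense f.target) {U : TopologicalSpace.Opens M} (hU : (U : Set M) = f.source) :
    IsHolomorphicCompactification E (fun x : U => f (x : M)) where
  compact := inferInstance
  hausdorff := inferInstance
  isManifold := inferInstance
  isOpenEmbedding := by
    obtain ⟨U, hUo⟩ := U
    subst hU
    exact f.isOpenEmbedding_restrict
  isLocalDiffeomorph := by
    intro x
    have hne : Nonempty U := ⟨x⟩
    have hsub : f.source ⊆ U := hU.ge
    let g : OpenPartialHomeomorph U M' := f.subtypeRestr hne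
    have hgs : g.source = univ := by
      rw [OpenPartialHomeomorph.subtypeRestr_source]
      exact eq_univ_of_forall fun y => hU.le y.2
    have hgt : g.target ⊆ f.target := f.subtypeRestr_target_subset hne
    refine ⟨{ g.toPartialEquiv with
      open_source := g.open_source
      open_target := g.open_target
      contMDiffOn_toFun := ?_
      contMDiffOn_invFun := ?_ }, ?_, ?_⟩
    · exact hf.1.comp (contMDiff_subtype_val (n := ω)).contMDiffOn fun y _ => hU.le y.2
    · intro y hy
      refine contMDiffWithinAt_opens_of_val ?_
      exact (hf.2.mono hgt y hy).congr
        (fun y hy => OpenPartialHomeomorph.subtypeRestr_symm_apply f hne hy)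
        (OpenPartialHomeomorph.subtypeRestr_symm_apply f hne hy)
    · change x ∈ g.source
      rw [hgs]
      trivial
    · exact fun y _ => rfl
  denseRange := by
    refine hdense.mono fun y hy => ?_
    exact ⟨⟨f.symm y, hU.ge (f.map_target hy)⟩, f.right_inv hy⟩

end LVM

theorem mainTheorem7 {m n : ℕ} (hm : 0 < m) (hn : 2 * m < n) (Λ Λ' : Fin n → Fin m → ℂ)
    (hΛ : LVM.Admissible Λ) (hΛ' : LVM.Admissible Λ')
    (W : AffineSubspace ℝ (Fin m → ℂ)) (v : Fin m → ℂ) (hcross : LVM.CrossesWall Λ Λ' W v) :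
    -- the leaf spaces carry their quotient complex structures
    (∃ _ : ChartedSpace (LVM.Model n m) (LVM.N Λ), LVM.IsQuotientComplexStructure Λ) ∧
    (∃ _ : ChartedSpace (LVM.Model n m) (LVM.N Λ'), LVM.IsQuotientComplexStructure Λ') ∧
    -- and for these complex structures the following holds
    ∀ [ChartedSpace (LVM.Model n m) (LVM.N Λ)] [ChartedSpace (LVM.Model n m) (LVM.N Λ')],
      LVM.IsQuotientComplexStructure Λ → LVM.IsQuotientComplexStructure Λ' →
      ∀ (I I' : Set (Fin n)), I = LVM.farIndices Λ W → I' = LVM.farIndices Λ' (v +ᵥ W) →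
      -- the centers of the surgery are nonempty holomorphic submanifolds
      (LVM.coordLocus Λ I).Nonempty ∧ (LVM.coordLocus Λ' I').Nonempty ∧
      0 < I.ncard ∧ 0 < I'.ncard ∧
      LVM.IsComplexSubmanifold (LVM.Model n m) (LVM.coordLocus Λ I) I.ncard ∧
      LVM.IsComplexSubmanifold (LVM.Model n m) (LVM.coordLocus Λ' I') I'.ncard ∧
      -- the identity in homogeneous coordinates induces a biholomorphism `f` between the complements
      -- of the centers, and thereby a holomorphic surgery
      ∃ f : OpenPartialHomeomorph (LVM.N Λ) (LVM.N Λ'),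
        (∀ (z : LVM.cone Λ) (z' : LVM.cone Λ'), (z : Fin n → ℂ) = (z' : Fin n → ℂ) →
          f (LVM.proj Λ z) = LVM.proj Λ' z') ∧
        LVM.IsHolomorphicSurgery (LVM.Model n m)
          (LVM.coordLocus Λ I) Set.univ (LVM.coordLocus Λ' I') Set.univ f ∧
        -- both manifolds are holomorphic compactifications of the complement of the first center
        ∃ U : TopologicalSpace.Opens (LVM.N Λ), (U : Set (LVM.N Λ)) = (LVM.coordLocus Λ I)ᶜ ∧
          LVM.IsHolomorphicCompactification (LVM.Model n m) (fun x : U => (x : LVM.N Λ)) ∧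
          LVM.IsHolomorphicCompactification (LVM.Model n m) (fun x : U => f (x : LVM.N Λ)) := by
  classical
  refine ⟨⟨_, LVM.isQuotientComplexStructure_leafChartedSpace hm hΛ⟩,
    ⟨_, LVM.isQuotientComplexStructure_leafChartedSpace hm hΛ'⟩, ?_⟩
  intro _ _ hQ hQ' I I' hI hI'
  obtain ⟨A, T, a, b, hpath, hA, hA', hfar, hfar'⟩ := hcross.exists_wallPath hn
  rw [hfar] at hI
  rw [hfar'] at hI'
  have hrev := hpath.reverse
  have hA'r : Λ' = LVM.translate A (-b • -v) := by rw [hA', neg_smul_neg]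
  have hAr : Λ = LVM.translate A (a • -v) := by rw [hA, smul_neg, neg_smul]
  -- the supports of the points of the two cones
  have hpos : ∀ z ∈ LVM.cone Λ, ∃ i ∈ I', z i ≠ 0 := by
    intro z hz
    obtain ⟨i, hi, hi'⟩ := hpath.exists_pos (S := {i | z i ≠ 0}) (by rw [← hA]; exact hz)
    exact ⟨i, hI' ▸ hi', hi⟩
  have hneg : ∀ z ∈ LVM.cone Λ', ∃ i ∈ I, z i ≠ 0 := by
    intro z hz
    obtain ⟨i, hi, hi'⟩ := hrev.exists_pos (S := {i | z i ≠ 0}) (by rw [← hA'r]; exact hz)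
    rw [LVM.rePair_neg, neg_pos] at hi'
    exact ⟨i, hI ▸ hi', hi⟩
  have hcone : ∀ z ∈ LVM.cone Λ, (∃ i ∈ I, z i ≠ 0) → z ∈ LVM.cone Λ' ∧ ∃ i ∈ I', z i ≠ 0 := by
    rintro z hz ⟨i, hi, hzi⟩
    refine ⟨?_, hpos z hz⟩
    have := hpath.mem_convexHull hm (S := {i | z i ≠ 0}) (by rw [← hA]; exact hz) hzi
      (by rw [hI] at hi; exact hi)
    rw [← hA'] at this
    exact this
  have hcone' : ∀ z ∈ LVM.cone Λ', (∃ i ∈ I', z i ≠ 0) → z ∈ LVM.cone Λ ∧ ∃ i ∈ I, z i ≠ 0 := by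
    rintro z hz ⟨i, hi, hzi⟩
    refine ⟨?_, hneg z hz⟩
    have := hrev.mem_convexHull hm (S := {i | z i ≠ 0}) (by rw [← hA'r]; exact hz) hzi
      (by rw [hI'] at hi; rw [LVM.rePair_neg, neg_lt_zero]; exact hi)
    rw [← hAr] at this
    exact this
  have hne : (LVM.coordLocus Λ I).Nonempty := by
    have h := hpath.zero_mem_convexHull_nonneg hm
    rw [← hA] at h
    refine ⟨_, ⟨⟨fun i => if 0 ≤ LVM.rePair T (A i) then 1 else 0, ?_⟩, fun i hi => ?_, rfl⟩⟩
    · change (0 : Fin m → ℂ) ∈ convexHull ℝ _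
      simpa using h
    · rw [hI] at hi
      exact if_neg (not_le.2 hi)
  have hne' : (LVM.coordLocus Λ' I').Nonempty := by
    have h := hrev.zero_mem_convexHull_nonneg hm
    rw [← hA'r] at h
    refine ⟨_, ⟨⟨fun i => if 0 ≤ LVM.rePair (-T) (A i) then 1 else 0, ?_⟩, fun i hi => ?_, rfl⟩⟩
    · change (0 : Fin m → ℂ) ∈ convexHull ℝ _
      simpa using h
    · rw [hI'] at hi
      refine if_neg (not_le.2 ?_)
      rw [LVM.rePair_neg, neg_lt_zero]
      exact hi
  have hNe : Nonempty (LVM.N Λ) := ⟨hne.some⟩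
  have hNe' : Nonempty (LVM.N Λ') := ⟨hne'.some⟩
  have hInon : I.Nonempty := by
    obtain ⟨p, -⟩ := hne'
    obtain ⟨z, -⟩ := LVM.proj_surjective p
    obtain ⟨i, hi, -⟩ := hneg z z.2
    exact ⟨i, hi⟩
  have hInon' : I'.Nonempty := by
    obtain ⟨p, -⟩ := hne
    obtain ⟨z, -⟩ := LVM.proj_surjective p
    obtain ⟨i, hi, -⟩ := hpos z z.2
    exact ⟨i, hi⟩
  have hsub := LVM.isComplexSubmanifold_coordLocus hm hΛ hQ I
  have hsub' := LVM.isComplexSubmanifold_coordLocus hm hΛ' hQ' I'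
  obtain ⟨f, hfs, hft, hf, hfproj⟩ :=
    LVM.exists_biholomorphism hQ hQ' hcross.eq_translate hcone hcone'
  have := LVM.compactSpace_N hm hΛ
  have := LVM.compactSpace_N hm hΛ'
  have := LVM.t2Space_N hm hΛ
  have := LVM.t2Space_N hm hΛ'
  have := hQ.isManifold
  have := hQ'.isManifold
  have hopen := (LVM.isClosed_coordLocus (Λ := Λ) I).isOpen_compl
  refine ⟨hne, hne', (Set.ncard_pos).2 hInon, (Set.ncard_pos).2 hInon', hsub, hsub', f, hfproj,
    ?_, ⟨⟨(LVM.coordLocus Λ I)ᶜ, hopen⟩, rfl, ?_, ?_⟩⟩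
  · exact
      { isClosed := LVM.isClosed_coordLocus I
        submanifold := ⟨_, hsub⟩
        isOpen := isOpen_univ
        subset := Set.subset_univ _
        isClosed' := LVM.isClosed_coordLocus I'
        submanifold' := ⟨_, hsub'⟩
        isOpen' := isOpen_univ
        subset' := Set.subset_univ _
        source_eq := by rw [hfs, Set.compl_eq_univ_sdiff]
        target_eq := by rw [hft, Set.compl_eq_univ_sdiff]
        biholomorphic := hf
        gluing := ⟨f, hfs, hft, hf, fun _ _ => rfl⟩ }
  · exact LVM.isHolomorphicCompactification_of_isBiholomorphic
      (f := OpenPartialHomeomorph.ofSet (LVM.coordLocus Λ I)ᶜ hopen)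
      ⟨contMDiffOn_id, contMDiffOn_id⟩ (LVM.dense_compl_coordLocus hInon) rfl
  · exact LVM.isHolomorphicCompactification_of_isBiholomorphic hf
      (hft ▸ LVM.dense_compl_coordLocus hInon') hfs.symm
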